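/- Let $\mathcal I_I$ be the space of immersed curves $\gamma\in H^2([0,1];\mathbb R^3)$ with $|\gamma(t)|=1$ and $\gamma'(t)\neq 0$ for all $t\in[0,1]$, $\gamma(0)=\gamma(1)=e_1$ and $\gamma'(0)=\gamma'(1)=e_2$, with the topology of the Sobolev metric $H^2$. Let $\mathcal L_I\subset\mathcal I_I$ be the subspace of locally convex curves, i.e. those of positive geodesic curvature: $\det(\gamma(t),\gamma'(t),\gamma''(t))>0$ for almost every $t\in[0,1]$. For $\gamma\in\mathcal I_I$ let $\mathfrak F_\gamma:[0,1]\to SO(3)$ be its Frenet frame, the matrix with columns $\gamma$, $\gamma'/|\gamma'|$ and $\gamma\times\gamma'/|\gamma'|$, and let $\tilde{\mathfrak F}_\gamma:[0,1]\to\mathbb S^3$ be its lift with $\tilde{\mathfrak F}_\gamma(0)=1$ through the canonical double cover $\mathbb S^3\to SO(3)$, where $\mathbb S^3$ is the group of unit quaternions. For $\varepsilon\in\{+1,-1\}$ let $\mathcal I_\varepsilon=\{\gamma\in\mathcal I_I:\tilde{\mathfrak F}_\gamma(1)=\varepsilon\}$ and $\mathcal L_\varepsilon=\mathcal I_\varepsilon\cap\mathcal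 L_I$. Theorem. For $\varepsilon=+1$ and for $\varepsilon=-1$ the inclusion $\mathcal L_\varepsilon\to\mathcal I_\varepsilon$ is weakly homotopically surjective: for every compact space $K$ and every continuous map $f:K\to\mathcal I_\varepsilon$ there are a continuous map $g:K\to\mathcal L_\varepsilon$ and a continuous map $H:[0,1]\times K\to\mathcal I_\varepsilon$ with $H(0,k)=f(k)$ and $H(1,k)=g(k)$ for all $k\in K$. -/

import Mathlib

open MeasureTheory
open scoped unitInterval Quaternion

universe u

noncomputable section

namespace LittleSpaces

/-- Euclidean space `ℝ³`. -/
abbrev E3 : Type := EuclideanSpace ℝ (Fin 3)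

/-- The standard basis vectors of `ℝ³`. -/
def e (i : Fin 3) : E3 := EuclideanSpace.single i 1

/-- The `3 × 3` matrix with columns `a`, `b`, `c`. -/
def cols (a b c : E3) : Matrix (Fin 3) (Fin 3) ℝ :=
  Matrix.of fun i => ![a i, b i, c i]

/-- The cross product of `ℝ³`. -/
def cross (a b : E3) : E3 := WithLp.toLp 2 (crossProduct (WithLp.ofLp a) (WithLp.ofLp b))

/-! ### The Sobolev space of curves -/

/-- The Sobolev space `H²([0,1]; ℝ³)`: curves `pos` with a continuous derivative `vel`, which is an
indefinite integral of a function `acc` in `L²`. Both `vel` and `acc` are determined by `pos`. -/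
@[ext]
structure H2Curve where
  /-- the curve `γ` -/
  pos : C(I, E3)
  /-- the derivative `γ'` -/
  vel : C(I, E3)
  /-- the second derivative `γ''`, an element of `L²` -/
  acc : Lp E3 2 (volume : Measure I)
  pos_eq : ∀ t : I, pos t = pos 0 + ∫ s in Set.Iic t, vel s
  vel_eq : ∀ t : I, vel t = vel 0 + ∫ s in Set.Iic t, acc s

/-- The embedding `γ ↦ (γ, γ', γ'')` of `H²` in `L² × L² × L²`. -/
def H2Curve.toL2 (γ : H2Curve) :
    Lp E3 2 (volume : Measure I) × Lp E3 2 (volume : Measure I) × Lp E3 2 (volume : Measure I) :=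
  (ContinuousMap.toLp 2 volume ℝ γ.pos, ContinuousMap.toLp 2 volume ℝ γ.vel, γ.acc)

/-- The topology of the Sobolev metric `H²`: convergence in `L²` of `γ`, `γ'` and `γ''`. -/
instance : TopologicalSpace H2Curve := TopologicalSpace.induced H2Curve.toL2 inferInstance

/-! ### Immersions and locally convex curves -/

/-- Immersions `γ : [0,1] → S²` with `γ(0) = γ(1) = e₁` and `γ'(0) = γ'(1) = e₂`. -/
def Immersions : Set H2Curve :=
  {γ | (∀ t, ‖γ.pos t‖ = 1) ∧ (∀ t, γ.vel t ≠ 0) ∧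
    γ.pos 0 = e 0 ∧ γ.pos 1 = e 0 ∧ γ.vel 0 = e 1 ∧ γ.vel 1 = e 1}

/-- Curves in `Immersions` of positive geodesic curvature. -/
def LocallyConvex : Set H2Curve :=
  {γ | γ ∈ Immersions ∧ ∀ᵐ t : I, 0 < (cols (γ.pos t) (γ.vel t) (γ.acc t)).det}

/-- The Frenet frame of an immersion into the sphere: the matrix with columns `γ`, `γ'/|γ'|` and
`γ × γ'/|γ'|`. -/
def frenet (γ : H2Curve) (t : I) : Matrix (Fin 3) (Fin 3) ℝ :=
  cols (γ.pos t) (‖γ.vel t‖⁻¹ • γ.vel t) (cross (γ.pos t) (‖γ.vel t‖⁻¹ • γ.vel t))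

/-- The quaternion units `i`, `j`, `k`. -/
def quatUnit (j : Fin 3) : ℍ[ℝ] :=
  (Quaternion.equivProd ℝ).symm (0, ![(1, 0, 0), (0, 1, 0), (0, 0, 1)] j)

/-- The coordinates of the imaginary part of a quaternion. -/
def imCoord (z : ℍ[ℝ]) : Fin 3 → ℝ := ![z.imI, z.imJ, z.imK]

/-- The canonical projection `S³ → SO(3)`: the matrix of `v ↦ z v z̄` on the imaginary
quaternions, in the basis `i`, `j`, `k`. -/
def proj (z : ℍ[ℝ]) : Matrix (Fin 3) (Fin 3) ℝ :=
  Matrix.of fun i j => imCoord (z * quatUnit j * star z) i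

/-- The set of `γ` in `Immersions` for which the lift to `S³` of the Frenet frame that starts at
`1` ends at `ε`, for `ε = ±1`. -/
def ImmersionsSign (ε : ℤˣ) : Set H2Curve :=
  {γ | γ ∈ Immersions ∧ ∃ q : C(I, ℍ[ℝ]), (∀ t, ‖q t‖ = 1) ∧ (∀ t, proj (q t) = frenet γ t) ∧
    q 0 = 1 ∧ q 1 = ((ε : ℤ) : ℍ[ℝ])}

/-- The locally convex curves in `ImmersionsSign ε`. -/
def LocallyConvexSign (ε : ℤˣ) : Set H2Curve := ImmersionsSign ε ∩ LocallyConvex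

/-- The inclusion of the locally convex curves in the immersions. -/
def inclusion (ε : ℤˣ) : C(LocallyConvexSign ε, ImmersionsSign ε) where
  toFun γ := ⟨γ.1, γ.2.1⟩
  continuous_toFun := by fun_prop

/-- A continuous map `i : X → Y` is weakly homotopically surjective if every continuous map from a
compact space to `Y` is homotopic to one that factors through `i`. -/
def WeaklyHomotopicallySurjective {X Y : Type*} [TopologicalSpace X] [TopologicalSpace Y]
    (i : C(X, Y)) : Prop :=
  ∀ (K : Type u) [TopologicalSpace K] [CompactSpace K] (f : C(K, Y)),
    ∃ g : C(K, X), f.Homotopic (i.comp g)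

end LittleSpaces

end

noncomputable section

namespace LittleSpaces

/-! A curve becomes locally convex if it is made to run through many fast convex loops while it
slowly follows its old course: with frequency `M`, the determinant of position, velocity and
acceleration is `M ^ 3` times that of the loop, up to lower order. The point is to insert the loops
by a homotopy through immersions, with no restriction on the family.

All deformations take place among curves in `ℝ³` with `η × η' ≠ 0`, and are then projected radially
to the sphere. The projection changes the determinant only by a positive factor. The family is first
moved, along segments, to a nearby `C³` family `η` with the same endpoint data
(`exists_C3Family_regular`). Then `η` is replaced by `A η + s (B η' + G η × η')`, where the
coefficients are trigonometric polynomials in `M t` that depend on `s ∈ [0,1]`. At `s = 0` this is a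
positive multiple of `η`. For small `s` it draws small figure eights, whose rotation number is zero.
One lobe is then pushed across the antipodal point, which a sphere allows, and at `s = 1` the loop
is locally convex.

Two explicit facts about the loop carry the argument: it is immersed for `s > 0`
(`loop_minors_ne_zero`), and at `s = 0` the infinitesimal figure eight points forward wherever it is
tangent to `η` (`loop_zero_ne_zero`), so that it cannot cancel the slow motion. Position × velocity
is, up to a factor, a convex combination of a slow term of weight `l = 1 / (1 + M s)` and a fast
term of weight `1 - l`. For large `M` either `l` or `s` is small, and compactness gives immersions
(`C3Family.eventually_cross_loopFamily_ne_zero`). Convexity at `s = 1` rests on `loop_det_pos`. A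
change of time restores the end velocities.

The sign `ε` needs no computation: a lift of the Frenet frame can be carried to nearby frames, so
the sign is constant along paths of immersions. -/

/-! ### Primitives of `L²` functions and the Sobolev embedding. -/

theorem setIntegral_Iic_coe {E : Type*} [NormedAddCommGroup E] [NormedSpace ℝ E] (f : ℝ → E)
    (t : I) : ∫ s : I in Set.Iic t, f s = ∫ s in (0 : ℝ)..t, f s := by
  have h1 : (Set.Iic t : Set I) = Subtype.val ⁻¹' (Set.Iic (t : ℝ)) := rfl
  rw [h1, intervalIntegral.integral_of_le t.2.1]
  rw [← (MeasurableEmbedding.subtype_coe measurableSet_Icc).setIntegral_map (μ := (volume : Measure I)) (g := f)]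
  have h2 : Measure.map (Subtype.val : I → ℝ) volume = volume.restrict I :=
    map_comap_subtype_coe measurableSet_Icc _
  rw [h2, Measure.restrict_restrict measurableSet_Iic, ← integral_Icc_eq_integral_Ioc]
  congr 2
  ext x
  simp only [Set.mem_inter_iff, Set.mem_Iic, Set.mem_Icc]
  constructor
  · rintro ⟨a, b, c⟩; exact ⟨b, a⟩
  · rintro ⟨a, b⟩; exact ⟨b, a, b.trans t.2.2⟩

section Sobolev

variable {E : Type*} [NormedAddCommGroup E]

theorem integral_norm_le_norm_Lp (g : Lp E 2 (volume : Measure I)) : ∫ s, ‖g s‖ ≤ ‖g‖ := by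
  rw [Lp.norm_def, integral_norm_eq_lintegral_enorm (Lp.aestronglyMeasurable g),
    ← eLpNorm_one_eq_lintegral_enorm]
  exact ENNReal.toReal_mono (Lp.eLpNorm_ne_top g)
    (eLpNorm_le_eLpNorm_of_exponent_le one_le_two (Lp.aestronglyMeasurable g))

theorem integrable_coe_Lp (g : Lp E 2 (volume : Measure I)) : Integrable g volume :=
  (Lp.memLp g).integrable one_le_two

variable [NormedSpace ℝ E]

theorem norm_setIntegral_le_norm_Lp (g : Lp E 2 (volume : Measure I)) (A : Set I) :
    ‖∫ s in A, g s‖ ≤ ‖g‖ :=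
  (norm_integral_le_integral_norm _).trans
    ((setIntegral_le_integral (integrable_coe_Lp g).norm
      (Filter.Eventually.of_forall fun _ => norm_nonneg _)).trans (integral_norm_le_norm_Lp g))

/-- The Sobolev embedding of `H¹` in the continuous functions. -/
theorem norm_le_of_eq_primitive (w : C(I, E)) (g : Lp E 2 (volume : Measure I))
    (h : ∀ t : I, w t = w 0 + ∫ s in Set.Iic t, g s) :
    ‖w‖ ≤ ‖ContinuousMap.toLp 2 volume ℝ w‖ + 2 * ‖g‖ := by
  rw [ContinuousMap.norm_le _ (by positivity)]
  intro t
  -- Averaging this bound over `s`, in a probability space, replaces `‖w s‖` by an `L¹` norm, which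
  -- the `L²` norm dominates.
  have h1 : ∀ s, ‖w t‖ ≤ ‖w s‖ + 2 * ‖g‖ := by
    intro s
    have h2 : w t = w s + ((∫ s in Set.Iic t, g s) - ∫ x in Set.Iic s, g x) := by
      rw [h t, h s]; abel
    rw [h2]
    refine (norm_add_le _ _).trans ?_
    have := norm_sub_le (∫ s in Set.Iic t, g s) (∫ x in Set.Iic s, g x)
    have := norm_setIntegral_le_norm_Lp g (Set.Iic t)
    have := norm_setIntegral_le_norm_Lp g (Set.Iic s)
    linarith
  have hw : Integrable (fun s => ‖w s‖) (volume : Measure I) :=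
    (w.continuous.integrable_of_hasCompactSupport (HasCompactSupport.of_compactSpace _)).norm
  have h3 : ∫ _ : I, ‖w t‖ ≤ ∫ s, (‖w s‖ + 2 * ‖g‖) :=
    integral_mono (integrable_const _) (hw.add (integrable_const _)) h1
  rw [integral_add hw (integrable_const _), integral_const, integral_const] at h3
  simp only [probReal_univ, smul_eq_mul, one_mul] at h3
  have h4 : ∫ s, ‖w s‖ = ∫ s, ‖ContinuousMap.toLp 2 (volume : Measure I) ℝ w s‖ :=
    integral_congr_ae (((ContinuousMap.coeFn_toLp volume w).symm).fun_comp norm)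
  have := integral_norm_le_norm_Lp (ContinuousMap.toLp 2 (volume : Measure I) ℝ w)
  linarith

/-- Initial segments form a π-system that generates the Borel sets, so equality of integrals spreads
to all measurable sets. -/
theorem Lp_ext_of_primitive [CompleteSpace E] {f g : Lp E 2 (volume : Measure I)}
    (h : ∀ t : I, ∫ s in Set.Iic t, f s = ∫ s in Set.Iic t, g s) : f = g := by
  have hf := integrable_coe_Lp f
  have hg := integrable_coe_Lp g
  have huniv : ∫ s, f s = ∫ s, g s := by
    have := h 1
    rwa [show Set.Iic (1 : I) = Set.univ from Set.Iic_top, setIntegral_univ,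
      setIntegral_univ] at this
  refine Lp.ext (hf.ae_eq_of_forall_setIntegral_eq _ _ hg fun s hs _ => ?_)
  induction s, hs using MeasurableSpace.induction_on_inter
    ((BorelSpace.measurable_eq (α := I)).trans (borel_eq_generateFrom_Iic I)) isPiSystem_Iic with
  | empty => simp
  | basic t ht =>
    obtain ⟨a, rfl⟩ := ht
    exact h a
  | compl t ht ih =>
    rw [setIntegral_compl ht hf, setIntegral_compl ht hg, ih (measure_lt_top _ _), huniv]
  | iUnion u hd hm ih =>
    rw [integral_iUnion hm hd hf.integrableOn, integral_iUnion hm hd hg.integrableOn]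
    exact tsum_congr fun i => ih i (measure_lt_top _ _)

end Sobolev

/-- Makes `ContinuousMap.toLp` injective, so that a continuous velocity is determined by its class
in `L²`. -/
instance : (volume : Measure I).IsOpenPosMeasure := by
  refine ⟨fun U hU hne h0 => ?_⟩
  obtain ⟨V, hV, rfl⟩ := isOpen_induced_iff.1 hU
  obtain ⟨x, hx⟩ := hne
  have hc : (x : ℝ) ∈ closure (Set.Ioo (0 : ℝ) 1) := by
    rw [closure_Ioo zero_ne_one]; exact x.2
  obtain ⟨y, hyV, hy⟩ := mem_closure_iff.1 hc V hV hx
  have hpos : 0 < volume (V ∩ Set.Ioo (0 : ℝ) 1) :=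
    (hV.inter isOpen_Ioo).measure_pos volume ⟨y, hyV, hy⟩
  have himg : volume (Subtype.val '' (Subtype.val ⁻¹' V : Set I)) = 0 :=
    (comap_subtype_coe_apply measurableSet_Icc volume _).symm.trans h0
  refine hpos.ne' (measure_mono_null ?_ himg)
  rintro z ⟨hz, hz'⟩
  exact ⟨⟨z, hz'.1.le, hz'.2.le⟩, hz, rfl⟩

/-! ### The topology of the space of `H²` curves. -/

namespace H2Curve

theorem pos_eq_toLp (γ : H2Curve) (t : I) :
    γ.pos t = γ.pos 0 + ∫ s in Set.Iic t, ContinuousMap.toLp 2 (volume : Measure I) ℝ γ.vel s := by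
  rw [γ.pos_eq t]
  congr 1
  exact integral_congr_ae (ae_restrict_of_ae (ContinuousMap.coeFn_toLp volume γ.vel).symm)

theorem eq_of_pos_eq {γ γ' : H2Curve} (h : γ.pos = γ'.pos) : γ = γ' := by
  have h1 : γ.vel = γ'.vel := by
    apply ContinuousMap.toLp_injective (p := 2) (𝕜 := ℝ) (volume : Measure I)
    apply Lp_ext_of_primitive
    intro t
    have a := γ.pos_eq_toLp t
    have b := γ'.pos_eq_toLp t
    rw [h, b] at a
    exact (add_left_cancel a).symm
  have h2 : γ.acc = γ'.acc := by
    apply Lp_ext_of_primitive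
    intro t
    have a := γ.vel_eq t
    have b := γ'.vel_eq t
    rw [h1, b] at a
    exact (add_left_cancel a).symm
  exact H2Curve.ext h h1 h2

theorem continuous_toL2 : Continuous H2Curve.toL2 := continuous_induced_dom

theorem continuous_acc : Continuous H2Curve.acc :=
  continuous_snd.comp (continuous_snd.comp continuous_toL2)

theorem continuous_toLp_pos :
    Continuous fun γ : H2Curve => ContinuousMap.toLp 2 (volume : Measure I) ℝ γ.pos :=
  continuous_fst.comp continuous_toL2

theorem continuous_toLp_vel :
    Continuous fun γ : H2Curve => ContinuousMap.toLp 2 (volume : Measure I) ℝ γ.vel :=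
  continuous_fst.comp (continuous_snd.comp continuous_toL2)

/-- The Sobolev bound, applied to `w x - w x₀`, upgrades continuity in `L²` to continuity in the
uniform norm. -/
theorem continuous_of_primitive {X E : Type*} [TopologicalSpace X] [NormedAddCommGroup E]
    [NormedSpace ℝ E] {w : X → C(I, E)} {g : X → Lp E 2 (volume : Measure I)}
    (h : ∀ x t, w x t = w x 0 + ∫ s in Set.Iic t, g x s)
    (hw : Continuous fun x => ContinuousMap.toLp 2 (volume : Measure I) ℝ (w x))
    (hg : Continuous g) : Continuous w := by
  rw [continuous_iff_continuousAt]
  intro x₀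
  rw [ContinuousAt, tendsto_iff_norm_sub_tendsto_zero]
  have hlim : Filter.Tendsto (fun x => ‖ContinuousMap.toLp 2 (volume : Measure I) ℝ (w x)
      - ContinuousMap.toLp 2 (volume : Measure I) ℝ (w x₀)‖ + 2 * ‖g x - g x₀‖) (nhds x₀)
      (nhds 0) := by
    have : Continuous (fun x => ‖ContinuousMap.toLp 2 (volume : Measure I) ℝ (w x)
      - ContinuousMap.toLp 2 (volume : Measure I) ℝ (w x₀)‖ + 2 * ‖g x - g x₀‖) := by fun_prop
    simpa using this.tendsto x₀
  refine squeeze_zero (fun _ => norm_nonneg _) (fun x => ?_) hlim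
  rw [← map_sub]
  refine norm_le_of_eq_primitive (w x - w x₀) (g x - g x₀) fun t => ?_
  rw [integral_congr_ae (ae_restrict_of_ae (Lp.coeFn_sub (g x) (g x₀)))]
  simp only [Pi.sub_apply]
  rw [integral_sub (integrable_coe_Lp _).integrableOn (integrable_coe_Lp _).integrableOn,
    ContinuousMap.sub_apply, ContinuousMap.sub_apply, h x t, h x₀ t]
  abel

theorem continuous_vel : Continuous H2Curve.vel :=
  continuous_of_primitive (fun γ t => γ.vel_eq t) continuous_toLp_vel continuous_acc

theorem continuous_pos : Continuous H2Curve.pos :=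
  continuous_of_primitive (fun γ t => γ.pos_eq_toLp t) continuous_toLp_pos continuous_toLp_vel

theorem continuous_iff {X : Type*} [TopologicalSpace X] {f : X → H2Curve} :
    Continuous f ↔ (Continuous fun x => (f x).pos) ∧ (Continuous fun x => (f x).vel) ∧
      Continuous fun x => (f x).acc := by
  refine ⟨fun h => ⟨continuous_pos.comp h, continuous_vel.comp h, continuous_acc.comp h⟩, ?_⟩
  rintro ⟨h1, h2, h3⟩
  refine continuous_induced_rng.2 (Continuous.prodMk ?_ (Continuous.prodMk ?_ h3))
  · exact (ContinuousLinearMap.continuous _).comp h1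
  · exact (ContinuousLinearMap.continuous _).comp h2

end H2Curve

/-! ### The product rule in `H¹`. -/

section ProductRule

variable {E : Type*} [NormedAddCommGroup E] [NormedSpace ℝ E]

/-- Integration over a set, as a continuous linear map on `L²`. -/
def setIntegralLp (A : Set I) : Lp E 2 (volume : Measure I) →L[ℝ] E :=
  LinearMap.mkContinuous
    { toFun := fun g => ∫ s in A, g s
      map_add' := fun f g => by
        rw [integral_congr_ae (ae_restrict_of_ae (Lp.coeFn_add f g))]
        exact integral_add (integrable_coe_Lp f).integrableOn (integrable_coe_Lp g).integrableOn
      map_smul' := fun c g => by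
        rw [integral_congr_ae (ae_restrict_of_ae (Lp.coeFn_smul c g))]
        exact integral_smul c _ } 1
    fun g => by simpa using norm_setIntegral_le_norm_Lp g A

theorem setIntegralLp_apply (A : Set I) (g : Lp E 2 (volume : Measure I)) :
    setIntegralLp A g = ∫ s in A, g s := rfl

theorem setIntegralLp_toLp (A : Set I) (f : C(I, E)) :
    setIntegralLp A (ContinuousMap.toLp 2 volume ℝ f) = ∫ s in A, f s :=
  integral_congr_ae (ae_restrict_of_ae (ContinuousMap.coeFn_toLp volume f))

/-- The pointwise action of a continuous operator valued function on `L²`. -/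
def actLp (M : C(I, E →L[ℝ] E)) (g : Lp E 2 (volume : Measure I)) :
    Lp E 2 (volume : Measure I) :=
  (ContinuousLinearMap.id ℝ (E →L[ℝ] E)).holderL volume ⊤ 2 2
    (ContinuousMap.toLp ⊤ volume ℝ M) g

theorem actLp_ae (M : C(I, E →L[ℝ] E)) (g : Lp E 2 (volume : Measure I)) :
    actLp M g =ᵐ[volume] fun s => M s (g s) := by
  refine (ContinuousLinearMap.coeFn_holder (r := 2) (ContinuousLinearMap.id ℝ (E →L[ℝ] E))
    (ContinuousMap.toLp ⊤ (volume : Measure I) ℝ M) g).trans ?_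
  filter_upwards [ContinuousMap.coeFn_toLp (p := ⊤) (𝕜 := ℝ) (volume : Measure I) M] with s hs
  rw [hs]
  rfl

theorem _root_.Continuous.actLp {X : Type*} [TopologicalSpace X] {M : X → C(I, E →L[ℝ] E)}
    {g : X → Lp E 2 (volume : Measure I)} (hM : Continuous M) (hg : Continuous g) :
    Continuous fun x => LittleSpaces.actLp (M x) (g x) :=
  ((((ContinuousLinearMap.id ℝ (E →L[ℝ] E)).holderL volume ⊤ 2 2).continuous.comp
    ((ContinuousLinearMap.continuous _).comp hM))).clm_apply hg

/-- The pointwise action of a continuous operator valued function on a continuous function. -/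
def actC (M : C(I, E →L[ℝ] E)) (w : C(I, E)) : C(I, E) :=
  ⟨fun t => M t (w t), M.continuous.clm_apply w.continuous⟩

theorem continuous_actC (M : C(I, E →L[ℝ] E)) : Continuous (actC M) :=
  ContinuousMap.continuous_of_continuous_uncurry _
    ((M.continuous.comp continuous_snd).clm_apply continuous_eval)

/-- The primitive of a continuous function on the unit interval. -/
def primitive (c : E) (f : C(I, E)) : C(I, E) :=
  ⟨fun t => c + ∫ s in (0 : ℝ)..t, f (Set.projIcc 0 1 zero_le_one s), by
    have h : Continuous fun s : ℝ => f (Set.projIcc 0 1 zero_le_one s) :=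
      f.continuous.comp continuous_projIcc
    exact continuous_const.add ((intervalIntegral.continuous_primitive
      (fun a b => h.intervalIntegrable a b) 0).comp continuous_subtype_val)⟩

theorem intervalIntegral_projIcc (f : C(I, E)) (t : I) :
    ∫ s in (0 : ℝ)..t, f (Set.projIcc 0 1 zero_le_one s) = ∫ s in Set.Iic t, f s := by
  rw [← setIntegral_Iic_coe]
  simp

/-- The product rule for an operator valued `C¹` function and an `H¹` function. -/
theorem act_eq_primitive [CompleteSpace E] {M M₁ : C(I, E →L[ℝ] E)} {N : ℝ → E →L[ℝ] E}
    (hN : ∀ t : I, N t = M t) (hN₁ : ∀ t : I, HasDerivAt N (M₁ t) t)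
    {w : C(I, E)} {g : Lp E 2 (volume : Measure I)}
    (hw : ∀ t : I, w t = w 0 + ∫ s in Set.Iic t, g s) (t : I) :
    M t (w t) = M 0 (w 0) + setIntegralLp (Set.Iic t)
      (ContinuousMap.toLp 2 volume ℝ (actC M₁ w) + actLp M g) := by
  let S : Set (C(I, E) × Lp E 2 (volume : Measure I)) :=
    {x | M t (x.1 t) = M 0 (x.1 0) + setIntegralLp (Set.Iic t)
      (ContinuousMap.toLp 2 volume ℝ (actC M₁ x.1) + actLp M x.2)}
  -- The identity is a closed condition on `(w, g)`. It holds by calculus when `g` is continuous,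
  -- and continuous functions are dense in `L²`.
  have hS : IsClosed S := by
    have e1 : ∀ r : I, Continuous fun x : C(I, E) × Lp E 2 (volume : Measure I) =>
      M r (x.1 r) := fun r => (M r).continuous.comp
        ((continuous_eval_const r).comp continuous_fst)
    refine isClosed_eq (e1 t) ((e1 0).add ((ContinuousLinearMap.continuous _).comp
      (Continuous.add ?_ (continuous_const.actLp continuous_snd))))
    exact (ContinuousLinearMap.continuous _).comp ((continuous_actC M₁).comp continuous_fst)
  have hsmooth : ∀ (c : E) (f : C(I, E)),
      (primitive c f, ContinuousMap.toLp 2 (volume : Measure I) ℝ f) ∈ S := by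
    intro c f
    have hfc : Continuous fun s : ℝ => f (Set.projIcc 0 1 zero_le_one s) :=
      f.continuous.comp continuous_projIcc
    set W : ℝ → E := fun r => c + ∫ s in (0 : ℝ)..r, f (Set.projIcc 0 1 zero_le_one s) with hW
    have hWd : ∀ r, HasDerivAt W (f (Set.projIcc 0 1 zero_le_one r)) r := fun r =>
      (hfc.integral_hasStrictDerivAt 0 r).hasDerivAt.const_add c
    have hWI : ∀ r : I, W r = primitive c f r := fun r => rfl
    set F : C(I, E) := actC M₁ (primitive c f) + actC M f with hF
    have hd : ∀ r ∈ Set.uIcc (0 : ℝ) t, HasDerivAt (fun r => N r (W r))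
        (F (Set.projIcc 0 1 zero_le_one r)) r := by
      intro r hr
      rw [Set.uIcc_of_le t.2.1] at hr
      have hr' : r ∈ I := ⟨hr.1, hr.2.trans t.2.2⟩
      have e1 := (hN₁ ⟨r, hr'⟩).clm_apply (hWd r)
      rw [Set.projIcc_of_mem _ hr'] at e1 ⊢
      have e2 := hN ⟨r, hr'⟩
      simp only at e1 e2
      rw [e2] at e1
      exact e1
    have hint := intervalIntegral.integral_eq_sub_of_hasDerivAt hd
      ((F.continuous.comp continuous_projIcc).intervalIntegrable _ _)
    rw [intervalIntegral_projIcc] at hint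
    have hsum : setIntegralLp (Set.Iic t) (ContinuousMap.toLp 2 volume ℝ
        (actC M₁ (primitive c f)) + actLp M (ContinuousMap.toLp 2 volume ℝ f))
        = ∫ s in Set.Iic t, F s := by
      rw [← setIntegralLp_toLp, hF, map_add (ContinuousMap.toLp 2 volume ℝ)]
      congr 2
      apply Lp.ext
      filter_upwards [actLp_ae M (ContinuousMap.toLp 2 volume ℝ f),
        ContinuousMap.coeFn_toLp (p := 2) (𝕜 := ℝ) (volume : Measure I) f,
        ContinuousMap.coeFn_toLp (p := 2) (𝕜 := ℝ) (volume : Measure I) (actC M f)]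
        with s h1 h2 h3
      rw [h1, h2, h3]
      rfl
    show M t (primitive c f t) = M 0 (primitive c f 0) + _
    rw [hsum, hint, ← hWI, ← hWI, ← hN, ← hN]
    simp
  obtain ⟨f, hf⟩ := mem_closure_iff_seq_limit.1
    (ContinuousMap.toLp_denseRange E (volume : Measure I) ℝ (p := 2) (by simp) g)
  choose hf1 hf2 using hf
  choose h hh using hf1
  have hlim : Filter.Tendsto (fun n => primitive (w 0) (h n)) Filter.atTop (nhds w) := by
    rw [tendsto_iff_norm_sub_tendsto_zero] at hf2 ⊢
    refine squeeze_zero (fun _ => norm_nonneg _) (fun n => ?_) hf2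
    rw [ContinuousMap.norm_le _ (norm_nonneg _)]
    intro r
    have : (primitive (w 0) (h n) - w) r = setIntegralLp (Set.Iic r) (f n - g) := by
      rw [map_sub, ← hh n, setIntegralLp_toLp, setIntegralLp_apply, ContinuousMap.sub_apply, hw r,
        ← intervalIntegral_projIcc]
      simp [primitive]
    rw [this]
    exact norm_setIntegral_le_norm_Lp _ _
  have hmem : (w, g) ∈ S := by
    refine hS.mem_of_tendsto (hlim.prodMk_nhds hf2) (Filter.Eventually.of_forall fun n => ?_)
    have := hsmooth (w 0) (h n)
    rwa [hh n] at this
  exact hmem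

end ProductRule

/-! ### Families of `C²` curves as continuous maps to `H²`. -/

/-- A continuous family of curves of class `C²`, with their first two derivatives. -/
structure C2Family (X : Type*) [TopologicalSpace X] where
  /-- the curves -/
  pos : X → ℝ → E3
  /-- the first derivatives -/
  vel : X → ℝ → E3
  /-- the second derivatives -/
  acc : X → ℝ → E3
  continuous_pos : Continuous fun x : X × ℝ => pos x.1 x.2
  continuous_vel : Continuous fun x : X × ℝ => vel x.1 x.2
  continuous_acc : Continuous fun x : X × ℝ => acc x.1 x.2
  hasDerivAt_pos : ∀ x t, HasDerivAt (pos x) (vel x t) t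
  hasDerivAt_vel : ∀ x t, HasDerivAt (vel x) (acc x t) t

namespace C2Family

variable {X : Type*} [TopologicalSpace X]

/-- The restriction to the unit interval of a family of functions. -/
def restrict (f : X → ℝ → E3) (hf : Continuous fun x : X × ℝ => f x.1 x.2) (x : X) : C(I, E3) :=
  ⟨fun t => f x t, hf.comp (by fun_prop : Continuous fun t : I => (x, (t : ℝ)))⟩

theorem continuous_restrict {f : X → ℝ → E3} (hf : Continuous fun x : X × ℝ => f x.1 x.2) :
    Continuous (restrict f hf) :=
  ContinuousMap.continuous_of_continuous_uncurry _
    (hf.comp (by fun_prop : Continuous fun y : X × I => (y.1, (y.2 : ℝ))))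

theorem eq_add_integral_Iic {p v : ℝ → E3} (h : ∀ t, HasDerivAt p (v t) t) (hv : Continuous v)
    (t : I) : p t = p 0 + ∫ s : I in Set.Iic t, v s := by
  rw [setIntegral_Iic_coe v, intervalIntegral.integral_eq_sub_of_hasDerivAt (fun r _ => h r)
    (hv.intervalIntegrable _ _)]
  simp

/-- The curves in `H²` of a family of class `C²`. -/
def curve (f : C2Family X) (x : X) : H2Curve where
  pos := restrict f.pos f.continuous_pos x
  vel := restrict f.vel f.continuous_vel x
  acc := ContinuousMap.toLp 2 volume ℝ (restrict f.acc f.continuous_acc x)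
  pos_eq t := eq_add_integral_Iic (f.hasDerivAt_pos x)
    (f.continuous_vel.comp (by fun_prop : Continuous fun t : ℝ => (x, t))) t
  vel_eq t := by
    rw [← setIntegralLp_apply, setIntegralLp_toLp]
    exact eq_add_integral_Iic (f.hasDerivAt_vel x)
      (f.continuous_acc.comp (by fun_prop : Continuous fun t : ℝ => (x, t))) t

theorem curve_pos (f : C2Family X) (x : X) (t : I) : (f.curve x).pos t = f.pos x t := rfl

theorem curve_vel (f : C2Family X) (x : X) (t : I) : (f.curve x).vel t = f.vel x t := rfl

theorem curve_acc (f : C2Family X) (x : X) :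
    (f.curve x).acc =ᵐ[volume] fun t : I => f.acc x t :=
  ContinuousMap.coeFn_toLp volume _

theorem continuous_curve (f : C2Family X) : Continuous f.curve :=
  H2Curve.continuous_iff.2 ⟨continuous_restrict f.continuous_pos,
    continuous_restrict f.continuous_vel,
    (ContinuousLinearMap.continuous _).comp (continuous_restrict f.continuous_acc)⟩

end C2Family

/-! ### Calculus of the radial projection, and vector algebra in `ℝ³`. -/

/-- The radial projection to the unit sphere. -/
def radial (x : E3) : E3 := ‖x‖⁻¹ • x

theorem contDiffAt_norm_inv {x : E3} (hx : x ≠ 0) :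
    ContDiffAt ℝ (⊤ : ℕ∞) (fun y : E3 => ‖y‖⁻¹) x :=
  (contDiffAt_norm ℝ hx).inv (norm_ne_zero_iff.2 hx)

theorem contDiffAt_radial {x : E3} (hx : x ≠ 0) : ContDiffAt ℝ (⊤ : ℕ∞) radial x :=
  (contDiffAt_norm_inv hx).smul contDiffAt_id

theorem contDiffAt_fderiv_radial {x : E3} (hx : x ≠ 0) :
    ContDiffAt ℝ (⊤ : ℕ∞) (fderiv ℝ radial) x :=
  (contDiffAt_radial hx).fderiv_right (by simp)

theorem continuousAt_fderiv_fderiv_radial {x : E3} (hx : x ≠ 0) :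
    ContinuousAt (fderiv ℝ (fderiv ℝ radial)) x :=
  ((contDiffAt_fderiv_radial hx).fderiv_right (m := (⊤ : ℕ∞)) (by simp)).continuousAt

theorem fderiv_radial {x : E3} (hx : x ≠ 0) (w : E3) :
    fderiv ℝ radial x w = ‖x‖⁻¹ • w + (fderiv ℝ (fun y : E3 => ‖y‖⁻¹) x w) • x := by
  have h := (((contDiffAt_norm_inv hx).differentiableAt (by simp)).hasFDerivAt.smul
    (hasFDerivAt_id x)).fderiv
  have h' : radial = fun y : E3 => ‖y‖⁻¹ • id y := rfl
  rw [h']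
  erw [h]
  simp

/-- The first derivative at `y` is `h y • v + (D h y v) • y` with `h = ‖·‖⁻¹`, and differentiating
it along `v` again creates no direction besides `v` and `x`. Such terms do not affect the
determinant with `x` and `v`. -/
theorem fderiv_fderiv_radial {x : E3} (hx : x ≠ 0) (v : E3) :
    ∃ c d : ℝ, fderiv ℝ (fderiv ℝ radial) x v v = c • v + d • x := by
  set h : E3 → ℝ := fun y => ‖y‖⁻¹ with hh
  have e : (fun y => fderiv ℝ radial y v) =ᶠ[nhds x] fun y => h y • v + (fderiv ℝ h y v) • y := by
    filter_upwards [isOpen_ne.mem_nhds hx] with y hy using fderiv_radial hy v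
  have d1 : DifferentiableAt ℝ h x := (contDiffAt_norm_inv hx).differentiableAt (by simp)
  have d2 : DifferentiableAt ℝ (fderiv ℝ h) x :=
    ((contDiffAt_norm_inv hx).fderiv_right (m := (⊤ : ℕ∞)) (by simp)).differentiableAt (by simp)
  have d3 : DifferentiableAt ℝ (fderiv ℝ radial) x :=
    (contDiffAt_fderiv_radial hx).differentiableAt (by simp)
  have l : HasFDerivAt (fun y => fderiv ℝ radial y v)
      ((ContinuousLinearMap.apply ℝ E3 v).comp (fderiv ℝ (fderiv ℝ radial) x)) x :=
    (ContinuousLinearMap.apply ℝ E3 v).hasFDerivAt.comp x d3.hasFDerivAt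
  have d4 : DifferentiableAt ℝ (fun y => fderiv ℝ h y v) x :=
    d2.clm_apply (differentiableAt_const v)
  have r := (d1.hasFDerivAt.smul_const v).add (d4.hasFDerivAt.smul (hasFDerivAt_id x))
  have u := congrArg (fun L : E3 →L[ℝ] E3 => L v) (l.unique (r.congr_of_eventuallyEq e))
  refine ⟨2 * fderiv ℝ h x v, fderiv ℝ (fun y => fderiv ℝ h y v) x v, ?_⟩
  refine Eq.trans ?_ (u.trans ?_)
  · rfl
  · simp [two_mul, add_smul, add_assoc]

theorem norm_radial {x : E3} (hx : x ≠ 0) : ‖radial x‖ = 1 := by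
  rw [radial, norm_smul, norm_inv, norm_norm, inv_mul_cancel₀ (norm_ne_zero_iff.2 hx)]

theorem fderiv_norm_inv {x : E3} (hx : x ≠ 0) (w : E3) :
    fderiv ℝ (fun y : E3 => ‖y‖⁻¹) x w = -(‖x‖⁻¹ ^ 3 * inner ℝ x w) := by
  have hn : HasFDerivAt (fun y : E3 => ‖y‖ ^ 2) _ x := (hasStrictFDerivAt_norm_sq x).hasFDerivAt
  have hd : DifferentiableAt ℝ (fun y : E3 => ‖y‖⁻¹) x :=
    (contDiffAt_norm_inv hx).differentiableAt (by simp)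
  have e : (fun y : E3 => (‖y‖⁻¹ ^ 2) * ‖y‖ ^ 2) =ᶠ[nhds x] fun _ => 1 := by
    filter_upwards [isOpen_ne.mem_nhds hx] with y hy
    have := norm_ne_zero_iff.2 hy
    field_simp
  have r := ((hd.hasFDerivAt.pow 2).mul hn).congr_of_eventuallyEq e.symm
  have u := congrArg (fun L : E3 →L[ℝ] ℝ => L w) (r.unique (hasFDerivAt_const 1 x))
  have hx' := norm_ne_zero_iff.2 hx
  simp at u
  field_simp at u ⊢
  linarith

theorem fderiv_radial_of_inner_eq_zero {x w : E3} (hx : x ≠ 0) (h : inner ℝ x w = 0) :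
    fderiv ℝ radial x w = ‖x‖⁻¹ • w := by
  rw [fderiv_radial hx, fderiv_norm_inv hx, h, mul_zero, neg_zero, zero_smul, add_zero]

theorem cross_apply_zero (a b : E3) : cross a b 0 = a 1 * b 2 - a 2 * b 1 := by
  simp [cross, cross_apply]

theorem cross_apply_one (a b : E3) : cross a b 1 = a 2 * b 0 - a 0 * b 2 := by
  simp [cross, cross_apply]

theorem cross_apply_two (a b : E3) : cross a b 2 = a 0 * b 1 - a 1 * b 0 := by
  simp [cross, cross_apply]

theorem E3_ext {a b : E3} (h0 : a 0 = b 0) (h1 : a 1 = b 1) (h2 : a 2 = b 2) : a = b := by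
  ext i; fin_cases i <;> assumption

theorem det_cols (a b c : E3) : (cols a b c).det =
    a 0 * b 1 * c 2 - a 0 * c 1 * b 2 - b 0 * a 1 * c 2 + b 0 * c 1 * a 2 + c 0 * a 1 * b 2
      - c 0 * b 1 * a 2 := by
  rw [Matrix.det_fin_three]; simp [cols]

/-- Column operations. With `h = ‖x‖⁻¹` this is the effect of the radial projection, which thus
preserves the sign of the determinant. -/
theorem det_cols_scale (x v a : E3) (h c d c' : ℝ) :
    (cols (h • x) (h • v + c • x) (h • a + d • v + c' • x)).det = h ^ 3 * (cols x v a).det := by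
  simp only [det_cols, PiLp.add_apply, PiLp.smul_apply, smul_eq_mul]; ring

theorem cross_smul_add_smul_self (x : E3) (a b : ℝ) (w : E3) :
    cross x (a • w + b • x) = a • cross x w := by
  apply E3_ext <;>
    simp only [cross_apply_zero, cross_apply_one, cross_apply_two, PiLp.add_apply, PiLp.smul_apply,
      smul_eq_mul] <;> ring

theorem cross_zero_left (x : E3) : cross 0 x = 0 := by
  apply E3_ext <;> simp [cross_apply_zero, cross_apply_one, cross_apply_two]

theorem cross_zero_right (x : E3) : cross x 0 = 0 := by
  apply E3_ext <;> simp [cross_apply_zero, cross_apply_one, cross_apply_two]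

theorem ne_zero_of_cross_ne_zero {x y : E3} (h : cross x y ≠ 0) : x ≠ 0 := by
  rintro rfl; exact h (cross_zero_left y)

theorem inner_E3 (x y : E3) : inner ℝ x y = x 0 * y 0 + x 1 * y 1 + x 2 * y 2 := by
  rw [PiLp.inner_apply, Fin.sum_univ_three]
  simp [mul_comm]

theorem norm_sq_E3 (x : E3) : ‖x‖ ^ 2 = x 0 ^ 2 + x 1 ^ 2 + x 2 ^ 2 := by
  rw [← real_inner_self_eq_norm_sq, inner_E3]; ring

/-! ### Radial projection of `H²` curves. -/

namespace H2Curve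

/-- The extension of a curve in `H²` to a differentiable function on the line. -/
def extend (γ : H2Curve) (r : ℝ) : E3 :=
  γ.pos 0 + ∫ s in (0 : ℝ)..r, γ.vel (Set.projIcc 0 1 zero_le_one s)

theorem extend_coe (γ : H2Curve) (t : I) : γ.extend t = γ.pos t := by
  rw [extend, intervalIntegral_projIcc, ← γ.pos_eq]

theorem hasDerivAt_extend (γ : H2Curve) (t : I) : HasDerivAt γ.extend (γ.vel t) t := by
  have h : Continuous fun s : ℝ => γ.vel (Set.projIcc 0 1 zero_le_one s) :=
    γ.vel.continuous.comp continuous_projIcc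
  have := (h.integral_hasStrictDerivAt 0 (t : ℝ)).hasDerivAt.const_add (γ.pos 0)
  rwa [Set.projIcc_val] at this

variable {X : Type*} [TopologicalSpace X] {f : X → H2Curve}

theorem continuous_uncurry_pos (hc : Continuous f) :
    Continuous fun x : X × I => (f x.1).pos x.2 :=
  continuous_eval.comp ((continuous_pos.comp (hc.comp continuous_fst)).prodMk continuous_snd)

theorem continuous_uncurry_vel (hc : Continuous f) :
    Continuous fun x : X × I => (f x.1).vel x.2 :=
  continuous_eval.comp ((continuous_vel.comp (hc.comp continuous_fst)).prodMk continuous_snd)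

theorem continuous_fderiv_radial_pos (hc : Continuous f) (hf : ∀ x t, (f x).pos t ≠ 0) :
    Continuous fun x : X × I => fderiv ℝ radial ((f x.1).pos x.2) :=
  continuous_iff_continuousAt.2 fun x =>
    ContinuousAt.comp (f := fun x : X × I => (f x.1).pos x.2)
      (contDiffAt_fderiv_radial (hf x.1 x.2)).continuousAt (continuous_uncurry_pos hc).continuousAt

theorem continuous_fderiv_fderiv_radial_pos (hc : Continuous f) (hf : ∀ x t, (f x).pos t ≠ 0) :
    Continuous fun x : X × I =>
      fderiv ℝ (fderiv ℝ radial) ((f x.1).pos x.2) ((f x.1).vel x.2) :=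
  Continuous.clm_apply (continuous_iff_continuousAt.2 fun x =>
    ContinuousAt.comp (f := fun x : X × I => (f x.1).pos x.2)
      (continuousAt_fderiv_fderiv_radial (hf x.1 x.2)) (continuous_uncurry_pos hc).continuousAt)
    (continuous_uncurry_vel hc)

/-- The derivative of the radial projection along a curve. -/
def radialD (γ : H2Curve) (h : ∀ t, γ.pos t ≠ 0) : C(I, E3 →L[ℝ] E3) :=
  ⟨fun t => fderiv ℝ radial (γ.pos t),
    (continuous_fderiv_radial_pos (f := fun _ : Unit => γ) continuous_const fun _ => h).comp
      (by fun_prop : Continuous fun t : I => ((), t))⟩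

/-- The derivative of `radialD` along a curve. -/
def radialD₂ (γ : H2Curve) (h : ∀ t, γ.pos t ≠ 0) : C(I, E3 →L[ℝ] E3) :=
  ⟨fun t => fderiv ℝ (fderiv ℝ radial) (γ.pos t) (γ.vel t),
    (continuous_fderiv_fderiv_radial_pos (f := fun _ : Unit => γ) continuous_const fun _ => h).comp
      (by fun_prop : Continuous fun t : I => ((), t))⟩

/-- The radial projection to the sphere of a curve that avoids the origin. -/
def normalize (γ : H2Curve) (h : ∀ t, γ.pos t ≠ 0) : H2Curve where
  pos := ⟨fun t => radial (γ.pos t), continuous_iff_continuousAt.2 fun t =>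
    (contDiffAt_radial (h t)).continuousAt.comp γ.pos.continuous.continuousAt⟩
  vel := actC (γ.radialD h) γ.vel
  acc := ContinuousMap.toLp 2 volume ℝ (actC (γ.radialD₂ h) γ.vel) + actLp (γ.radialD h) γ.acc
  pos_eq t := by
    have hd : ∀ r ∈ Set.uIcc (0 : ℝ) t, HasDerivAt (fun r => radial (γ.extend r))
        (actC (γ.radialD h) γ.vel (Set.projIcc 0 1 zero_le_one r)) r := by
      intro r hr
      rw [Set.uIcc_of_le t.2.1] at hr
      have hr' : r ∈ I := ⟨hr.1, hr.2.trans t.2.2⟩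
      rw [Set.projIcc_of_mem _ hr']
      have e1 := γ.hasDerivAt_extend ⟨r, hr'⟩
      have e2 : HasFDerivAt radial (fderiv ℝ radial (γ.pos ⟨r, hr'⟩)) (γ.extend r) := by
        rw [← γ.extend_coe ⟨r, hr'⟩]
        refine ((contDiffAt_radial ?_).differentiableAt (by simp)).hasFDerivAt
        rw [γ.extend_coe]
        exact h _
      exact e2.comp_hasDerivAt r e1
    have := intervalIntegral.integral_eq_sub_of_hasDerivAt hd
      (((actC (γ.radialD h) γ.vel).continuous.comp continuous_projIcc).intervalIntegrable _ _)
    rw [intervalIntegral_projIcc, γ.extend_coe] at this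
    have h0 := γ.extend_coe 0
    rw [Set.Icc.coe_zero] at h0
    rw [h0] at this
    rw [this]
    simp
  vel_eq t := by
    refine act_eq_primitive (N := fun r => fderiv ℝ radial (γ.extend r)) (fun t => ?_)
      (fun t => ?_) γ.vel_eq t
    · rw [γ.extend_coe]; rfl
    · have e2 : HasFDerivAt (fderiv ℝ radial) (fderiv ℝ (fderiv ℝ radial) (γ.pos t))
          (γ.extend t) := by
        rw [γ.extend_coe]
        exact ((contDiffAt_fderiv_radial (h t)).differentiableAt (by simp)).hasFDerivAt
      exact e2.comp_hasDerivAt (t : ℝ) (γ.hasDerivAt_extend t)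

theorem normalize_pos (γ : H2Curve) (h : ∀ t, γ.pos t ≠ 0) (t : I) :
    (γ.normalize h).pos t = radial (γ.pos t) := rfl

theorem normalize_vel (γ : H2Curve) (h : ∀ t, γ.pos t ≠ 0) (t : I) :
    (γ.normalize h).vel t = fderiv ℝ radial (γ.pos t) (γ.vel t) := rfl

theorem normalize_acc (γ : H2Curve) (h : ∀ t, γ.pos t ≠ 0) : (γ.normalize h).acc =ᵐ[volume]
    fun t => fderiv ℝ (fderiv ℝ radial) (γ.pos t) (γ.vel t) (γ.vel t)
      + fderiv ℝ radial (γ.pos t) (γ.acc t) := by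
  filter_upwards [Lp.coeFn_add (ContinuousMap.toLp 2 volume ℝ (actC (γ.radialD₂ h) γ.vel))
    (actLp (γ.radialD h) γ.acc), actLp_ae (γ.radialD h) γ.acc,
    ContinuousMap.coeFn_toLp (p := 2) (𝕜 := ℝ) (volume : Measure I) (actC (γ.radialD₂ h) γ.vel)]
    with t h1 h2 h3
  refine Eq.trans h1 ?_
  rw [Pi.add_apply, h2, h3]
  rfl

theorem continuous_normalize (hc : Continuous f) (hf : ∀ x t, (f x).pos t ≠ 0) :
    Continuous fun x => (f x).normalize (hf x) := by
  have hD : Continuous fun x => (f x).radialD (hf x) :=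
    ContinuousMap.continuous_of_continuous_uncurry _ (continuous_fderiv_radial_pos hc hf)
  have hD₂ : Continuous fun x => (f x).radialD₂ (hf x) :=
    ContinuousMap.continuous_of_continuous_uncurry _ (continuous_fderiv_fderiv_radial_pos hc hf)
  refine continuous_iff.2 ⟨?_, ?_, ?_⟩
  · refine ContinuousMap.continuous_of_continuous_uncurry _ ?_
    exact continuous_iff_continuousAt.2 fun x =>
      ContinuousAt.comp (f := fun x : X × I => (f x.1).pos x.2)
        (contDiffAt_radial (hf x.1 x.2)).continuousAt (continuous_uncurry_pos hc).continuousAt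
  · refine ContinuousMap.continuous_of_continuous_uncurry _ ?_
    exact (continuous_fderiv_radial_pos hc hf).clm_apply (continuous_uncurry_vel hc)
  · refine Continuous.add ((ContinuousLinearMap.continuous _).comp ?_)
      (hD.actLp (continuous_acc.comp hc))
    refine ContinuousMap.continuous_of_continuous_uncurry _ ?_
    exact (continuous_fderiv_fderiv_radial_pos hc hf).clm_apply (continuous_uncurry_vel hc)

/-- Curves whose radial projection is an immersion with the prescribed endpoints. -/
structure Regular (γ : H2Curve) : Prop where
  cross_ne_zero : ∀ t, cross (γ.pos t) (γ.vel t) ≠ 0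
  pos_zero : γ.pos 0 = e 0
  pos_one : γ.pos 1 = e 0
  vel_zero : γ.vel 0 = e 1
  vel_one : γ.vel 1 = e 1

theorem Regular.pos_ne_zero {γ : H2Curve} (h : γ.Regular) (t : I) : γ.pos t ≠ 0 :=
  ne_zero_of_cross_ne_zero (h.cross_ne_zero t)

theorem norm_e (i : Fin 3) : ‖e i‖ = 1 := by simp [e]

theorem e_ne_zero (i : Fin 3) : e i ≠ 0 := norm_ne_zero_iff.1 (by rw [norm_e]; exact one_ne_zero)

theorem radial_eq_self {x : E3} (h : ‖x‖ = 1) : radial x = x := by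
  rw [radial, h, inv_one, one_smul]

theorem Regular.normalize_mem {γ : H2Curve} (h : γ.Regular) :
    γ.normalize h.pos_ne_zero ∈ Immersions := by
  have hv : fderiv ℝ radial (e 0) (e 1) = e 1 := by
    rw [fderiv_radial_of_inner_eq_zero (e_ne_zero 0) (by simp [inner_E3, e]), norm_e, inv_one,
      one_smul]
  refine ⟨fun t => norm_radial (h.pos_ne_zero t), fun t h0 => h.cross_ne_zero t ?_, ?_, ?_, ?_, ?_⟩
  · rw [normalize_vel, fderiv_radial (h.pos_ne_zero t)] at h0
    have h1 := cross_smul_add_smul_self (γ.pos t) ‖γ.pos t‖⁻¹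
      (fderiv ℝ (fun y : E3 => ‖y‖⁻¹) (γ.pos t) (γ.vel t)) (γ.vel t)
    rw [h0, cross_zero_right, eq_comm, smul_eq_zero] at h1
    exact h1.resolve_left (inv_ne_zero (norm_ne_zero_iff.2 (h.pos_ne_zero t)))
  · rw [normalize_pos, h.pos_zero, radial_eq_self (norm_e 0)]
  · rw [normalize_pos, h.pos_one, radial_eq_self (norm_e 0)]
  · rw [normalize_vel, h.pos_zero, h.vel_zero, hv]
  · rw [normalize_vel, h.pos_one, h.vel_one, hv]

theorem normalize_eq_self {γ : H2Curve} (h : γ ∈ Immersions) (h' : ∀ t, γ.pos t ≠ 0) :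
    γ.normalize h' = γ :=
  eq_of_pos_eq (ContinuousMap.ext fun t => radial_eq_self (h.1 t))

/-- The curve is its own radial projection, so its velocity is fixed by the derivative of the
projection, which subtracts the radial component. -/
theorem inner_pos_vel {γ : H2Curve} (h : γ ∈ Immersions) (t : I) :
    inner ℝ (γ.pos t) (γ.vel t) = 0 := by
  have hp : ∀ t, γ.pos t ≠ 0 := fun t => norm_ne_zero_iff.1 (by rw [h.1 t]; exact one_ne_zero)
  have h1 := γ.normalize_vel hp t
  rw [normalize_eq_self h, fderiv_radial (hp t), fderiv_norm_inv (hp t), h.1 t, inv_one, one_smul,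
    one_pow, one_mul, left_eq_add, smul_eq_zero] at h1
  exact neg_eq_zero.1 (h1.resolve_right (hp t))

theorem regular_of_mem_immersions {γ : H2Curve} (h : γ ∈ Immersions) : γ.Regular := by
  refine ⟨fun t h0 => h.2.1 t ?_, h.2.2.1, h.2.2.2.1, h.2.2.2.2.1, h.2.2.2.2.2⟩
  -- Lagrange's identity.
  have h1 : ‖cross (γ.pos t) (γ.vel t)‖ ^ 2 + inner ℝ (γ.pos t) (γ.vel t) ^ 2
      = ‖γ.pos t‖ ^ 2 * ‖γ.vel t‖ ^ 2 := by
    simp only [norm_sq_E3, inner_E3, cross_apply_zero, cross_apply_one, cross_apply_two]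
    ring
  rw [h0, inner_pos_vel h, h.1 t] at h1
  have h2 : ‖γ.vel t‖ ^ 2 = 0 := by simpa [eq_comm] using h1
  exact norm_eq_zero.1 (pow_eq_zero_iff two_ne_zero |>.1 h2)

theorem Regular.normalize_mem_locallyConvex {γ : H2Curve} (h : γ.Regular)
    (hd : ∀ᵐ t : I, 0 < (cols (γ.pos t) (γ.vel t) (γ.acc t)).det) :
    γ.normalize h.pos_ne_zero ∈ LocallyConvex := by
  refine ⟨h.normalize_mem, ?_⟩
  filter_upwards [hd, γ.normalize_acc h.pos_ne_zero] with t h1 h2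
  have hp := h.pos_ne_zero t
  obtain ⟨c, d, hcd⟩ := fderiv_fderiv_radial hp (γ.vel t)
  rw [h2, normalize_pos, normalize_vel, hcd, fderiv_radial hp, fderiv_radial hp, radial]
  set k := fderiv ℝ (fun y : E3 => ‖y‖⁻¹) (γ.pos t) (γ.vel t)
  set l := fderiv ℝ (fun y : E3 => ‖y‖⁻¹) (γ.pos t) (γ.acc t)
  have : c • γ.vel t + d • γ.pos t + (‖γ.pos t‖⁻¹ • γ.acc t + l • γ.pos t)
      = ‖γ.pos t‖⁻¹ • γ.acc t + c • γ.vel t + (d + l) • γ.pos t := by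
    rw [add_smul]; abel
  rw [this, det_cols_scale]
  have := norm_pos_iff.2 hp
  positivity

end H2Curve

/-! ### Quaternions and the lifting of frames. -/

section Quaternions

/-- The imaginary quaternion with given coordinates. -/
def quatVec (x : E3) : ℍ[ℝ] := x 0 • quatUnit 0 + x 1 • quatUnit 1 + x 2 • quatUnit 2

theorem quatUnit_re (i : Fin 3) : (quatUnit i).re = 0 := rfl
theorem quatUnit_imI (i : Fin 3) : (quatUnit i).imI = ![1, 0, 0] i := by fin_cases i <;> rfl
theorem quatUnit_imJ (i : Fin 3) : (quatUnit i).imJ = ![0, 1, 0] i := by fin_cases i <;> rfl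
theorem quatUnit_imK (i : Fin 3) : (quatUnit i).imK = ![0, 0, 1] i := by fin_cases i <;> rfl

theorem quatVec_re (x : E3) : (quatVec x).re = 0 := by
  simp [quatVec, quatUnit_re]
theorem quatVec_imI (x : E3) : (quatVec x).imI = x 0 := by
  simp [quatVec, quatUnit_imI]
theorem quatVec_imJ (x : E3) : (quatVec x).imJ = x 1 := by
  simp [quatVec, quatUnit_imJ]
theorem quatVec_imK (x : E3) : (quatVec x).imK = x 2 := by
  simp [quatVec, quatUnit_imK]

theorem continuous_quatVec : Continuous quatVec := by
  unfold quatVec; fun_prop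

theorem quatUnit_zero_sq : quatUnit 0 * quatUnit 0 = -1 := by
  ext <;> simp [quatUnit_re, quatUnit_imI, quatUnit_imJ, quatUnit_imK]
theorem quatUnit_one_sq : quatUnit 1 * quatUnit 1 = -1 := by
  ext <;> simp [quatUnit_re, quatUnit_imI, quatUnit_imJ, quatUnit_imK]
theorem quatUnit_zero_mul_one : quatUnit 0 * quatUnit 1 = quatUnit 2 := by
  ext <;> simp [quatUnit_re, quatUnit_imI, quatUnit_imJ, quatUnit_imK]
theorem quatUnit_one_mul_zero : quatUnit 1 * quatUnit 0 = -quatUnit 2 := by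
  ext <;> simp [quatUnit_re, quatUnit_imI, quatUnit_imJ, quatUnit_imK]
theorem quatUnit_two_mul_zero : quatUnit 2 * quatUnit 0 = quatUnit 1 := by
  ext <;> simp [quatUnit_re, quatUnit_imI, quatUnit_imJ, quatUnit_imK]
theorem quatUnit_two_mul_one : quatUnit 2 * quatUnit 1 = -quatUnit 0 := by
  ext <;> simp [quatUnit_re, quatUnit_imI, quatUnit_imJ, quatUnit_imK]
theorem quatUnit_two_sq : quatUnit 2 * quatUnit 2 = -1 := by
  ext <;> simp [quatUnit_re, quatUnit_imI, quatUnit_imJ, quatUnit_imK]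

theorem norm_quatUnit (i : Fin 3) : ‖quatUnit i‖ = 1 := by
  have : ‖quatUnit i‖ ^ 2 = 1 := by
    rw [sq, ← Quaternion.normSq_eq_norm_mul_self, Quaternion.normSq_def']
    fin_cases i <;> simp [quatUnit_re, quatUnit_imI, quatUnit_imJ, quatUnit_imK]
  exact (pow_eq_one_iff_of_nonneg (norm_nonneg _) two_ne_zero).1 this

theorem quatVec_sq {a : E3} (h : ‖a‖ = 1) : quatVec a * quatVec a = -1 := by
  have h1 := norm_sq_E3 a
  rw [h] at h1
  ext <;> simp [quatVec_re, quatVec_imI, quatVec_imJ, quatVec_imK] <;> linarith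

theorem quatVec_mul {a b : E3} (h : inner ℝ a b = 0) :
    quatVec a * quatVec b = quatVec (cross a b) := by
  rw [inner_E3] at h
  ext <;> simp [quatVec_re, quatVec_imI, quatVec_imJ, quatVec_imK, cross_apply_zero, cross_apply_one, cross_apply_two] <;> linarith

theorem quatVec_mul_comm {a b : E3} (h : inner ℝ a b = 0) :
    quatVec b * quatVec a = -(quatVec a * quatVec b) := by
  rw [inner_E3] at h
  ext <;> simp [quatVec_re, quatVec_imI, quatVec_imJ, quatVec_imK] <;> linarith

theorem star_mul_self_of_norm {z : ℍ[ℝ]} (h : ‖z‖ = 1) : star z * z = 1 := by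
  rw [Quaternion.star_mul_self, Quaternion.normSq_eq_norm_mul_self, h]; simp

theorem mul_star_self_of_norm {z : ℍ[ℝ]} (h : ‖z‖ = 1) : z * star z = 1 := by
  rw [Quaternion.self_mul_star, Quaternion.normSq_eq_norm_mul_self, h]; simp

/-- Turns the quadratic condition `proj z = frame` into relations linear in `z`, whose solutions can
be produced by averaging. -/
theorem mul_quatUnit_eq_of_proj {z : ℍ[ℝ]} (hz : ‖z‖ = 1) {i : Fin 3} {a : E3}
    (h : ∀ j, proj z j i = a j) : z * quatUnit i = quatVec a * z := by
  have hre : (z * quatUnit i * star z).re = 0 := by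
    fin_cases i <;> simp [quatUnit_re, quatUnit_imI, quatUnit_imJ, quatUnit_imK] <;> ring
  have h1 : z * quatUnit i * star z = quatVec a := by
    have h0 := h 0
    have h1 := h 1
    have h2 := h 2
    simp only [proj, imCoord, Matrix.of_apply, Matrix.cons_val] at h0 h1 h2
    ext
    exacts [hre.trans (quatVec_re a).symm, h0.trans (quatVec_imI a).symm,
      h1.trans (quatVec_imJ a).symm, h2.trans (quatVec_imK a).symm]
  rw [← h1, mul_assoc, star_mul_self_of_norm hz, mul_one]

theorem proj_of_mul_quatUnit_eq {z : ℍ[ℝ]} (hz : ‖z‖ = 1) {i : Fin 3} {a : E3}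
    (h : z * quatUnit i = quatVec a * z) (j : Fin 3) : proj z j i = a j := by
  have h1 : z * quatUnit i * star z = quatVec a := by
    rw [h, mul_assoc, mul_star_self_of_norm hz, mul_one]
  simp only [proj, Matrix.of_apply, h1]
  fin_cases j <;> simp [imCoord, quatVec_imI, quatVec_imJ, quatVec_imK]

/-- A quaternion that intertwines the standard frame with the frame `A`, `B`, `A * B`. -/
def intertwiner (A B q : ℍ[ℝ]) : ℍ[ℝ] :=
  q - A * q * quatUnit 0 - B * q * quatUnit 1 - A * B * q * quatUnit 2

/-- `intertwiner` is the sum of `α(g) q g⁻¹` over `g = 1, i, j, k`, where `α` sends `i, j, k` to `A,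
B, A * B`. The two multiplications permute its four terms in the same way. -/
theorem intertwiner_mul_zero {A B : ℍ[ℝ]} (hA : A * A = -1) (q : ℍ[ℝ]) :
    intertwiner A B q * quatUnit 0 = A * intertwiner A B q := by
  simp only [intertwiner, sub_mul, mul_sub, mul_assoc, quatUnit_zero_sq, quatUnit_one_mul_zero,
    quatUnit_two_mul_zero]
  simp only [← mul_assoc, hA]
  noncomm_ring

theorem intertwiner_mul_one {A B : ℍ[ℝ]} (hB : B * B = -1) (hAB : B * A = -(A * B))
    (q : ℍ[ℝ]) : intertwiner A B q * quatUnit 1 = B * intertwiner A B q := by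
  simp only [intertwiner, sub_mul, mul_sub, mul_assoc, quatUnit_one_sq, quatUnit_zero_mul_one,
    quatUnit_two_mul_one]
  have h : B * (A * B) = A := by rw [← mul_assoc, hAB, neg_mul, mul_assoc, hB]; simp
  simp only [← mul_assoc, hB, hAB]
  simp only [neg_mul, mul_assoc A B B, hB]
  noncomm_ring

theorem intertwiner_of_frame {A B q : ℍ[ℝ]} (h0 : q * quatUnit 0 = A * q)
    (h1 : q * quatUnit 1 = B * q) : intertwiner A B q = 4 * q := by
  have e0 : A * q * quatUnit 0 = -q := by rw [← h0, mul_assoc, quatUnit_zero_sq]; simp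
  have e1 : B * q * quatUnit 1 = -q := by rw [← h1, mul_assoc, quatUnit_one_sq]; simp
  have e2 : A * B * q * quatUnit 2 = -q := by
    rw [mul_assoc A, ← h1, ← mul_assoc A, ← h0, mul_assoc q, quatUnit_zero_mul_one, mul_assoc,
      quatUnit_two_sq]
    simp
  rw [intertwiner, e0, e1, e2]
  noncomm_ring

/-- For the frame of `q` itself the sum is `4 * q`, of norm `4`; the change of frame perturbs it by
less than that. -/
theorem intertwiner_ne_zero {A B A' B' q : ℍ[ℝ]} (hq : ‖q‖ = 1) (h0 : q * quatUnit 0 = A * q)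
    (h1 : q * quatUnit 1 = B * q) (h : ‖A' - A‖ + ‖B' - B‖ + ‖A' * B' - A * B‖ < 4) :
    intertwiner A' B' q ≠ 0 := by
  intro hw
  have e : intertwiner A' B' q = 4 * q - ((A' - A) * q * quatUnit 0 + (B' - B) * q * quatUnit 1
      + (A' * B' - A * B) * q * quatUnit 2) := by
    rw [← intertwiner_of_frame h0 h1, intertwiner, intertwiner]
    noncomm_ring
  have e2 : (4 : ℝ) ≤ ‖(A' - A) * q * quatUnit 0 + (B' - B) * q * quatUnit 1
      + (A' * B' - A * B) * q * quatUnit 2‖ := by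
    rw [← sub_eq_zero.1 (e.symm.trans hw), norm_mul, hq, mul_one]
    have : (4 : ℍ[ℝ]) = ((4 : ℝ) : ℍ[ℝ]) := by norm_cast
    rw [this, Quaternion.norm_coe]
    norm_num
  have e3 := (norm_add_le ((A' - A) * q * quatUnit 0 + (B' - B) * q * quatUnit 1)
    ((A' * B' - A * B) * q * quatUnit 2))
  have e4 := norm_add_le ((A' - A) * q * quatUnit 0) ((B' - B) * q * quatUnit 1)
  simp only [norm_mul, hq, norm_quatUnit, mul_one] at e2 e3 e4
  linarith

end Quaternions

/-! ### Invariance of the sign under homotopy. -/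

namespace H2Curve

/-- The unit tangent vector. -/
def tangent (γ : H2Curve) (t : I) : E3 := ‖γ.vel t‖⁻¹ • γ.vel t

theorem norm_tangent {γ : H2Curve} (h : γ ∈ Immersions) (t : I) : ‖γ.tangent t‖ = 1 := by
  rw [tangent, norm_smul, norm_inv, norm_norm, inv_mul_cancel₀ (norm_ne_zero_iff.2 (h.2.1 t))]

theorem inner_pos_tangent {γ : H2Curve} (h : γ ∈ Immersions) (t : I) :
    inner ℝ (γ.pos t) (γ.tangent t) = 0 := by
  rw [tangent, inner_smul_right, inner_pos_vel h, mul_zero]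

theorem continuous_uncurry_tangent {X : Type*} [TopologicalSpace X] {f : X → H2Curve}
    (hc : Continuous f) (hf : ∀ x, f x ∈ Immersions) :
    Continuous fun x : X × I => (f x.1).tangent x.2 :=
  ((continuous_uncurry_vel hc).norm.inv₀ fun x => norm_ne_zero_iff.2 ((hf x.1).2.1 x.2)).smul
    (continuous_uncurry_vel hc)

theorem continuous_tangent {γ : H2Curve} (h : γ ∈ Immersions) : Continuous γ.tangent :=
  (γ.vel.continuous.norm.inv₀ fun t => norm_ne_zero_iff.2 (h.2.1 t)).smul γ.vel.continuous

theorem frenet_apply_zero (γ : H2Curve) (t : I) (j : Fin 3) : frenet γ t j 0 = γ.pos t j := rfl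
theorem frenet_apply_one (γ : H2Curve) (t : I) (j : Fin 3) : frenet γ t j 1 = γ.tangent t j := rfl
theorem tangent_zero {γ : H2Curve} (h : γ ∈ Immersions) : γ.tangent 0 = e 1 := by
  rw [tangent, h.2.2.2.2.1, norm_e, inv_one, one_smul]

theorem tangent_one {γ : H2Curve} (h : γ ∈ Immersions) : γ.tangent 1 = e 1 := by
  rw [tangent, h.2.2.2.2.2, norm_e, inv_one, one_smul]

/-- The sign of an immersion is shared by the immersions with a close Frenet frame. -/
theorem mem_immersionsSign_of_close {ε : ℤˣ} {γ γ' : H2Curve} (h : γ ∈ ImmersionsSign ε)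
    (h' : γ' ∈ Immersions)
    (hclose : ∀ t, ‖quatVec (γ'.pos t) - quatVec (γ.pos t)‖
      + ‖quatVec (γ'.tangent t) - quatVec (γ.tangent t)‖
      + ‖quatVec (γ'.pos t) * quatVec (γ'.tangent t)
        - quatVec (γ.pos t) * quatVec (γ.tangent t)‖ < 4) : γ' ∈ ImmersionsSign ε := by
  obtain ⟨hγ, q, hq, hproj, q0, q1⟩ := h
  have a0 : ∀ t, q t * quatUnit 0 = quatVec (γ.pos t) * q t := fun t =>
    mul_quatUnit_eq_of_proj (hq t) fun j => by rw [hproj, frenet_apply_zero]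
  have a1 : ∀ t, q t * quatUnit 1 = quatVec (γ.tangent t) * q t := fun t =>
    mul_quatUnit_eq_of_proj (hq t) fun j => by rw [hproj, frenet_apply_one]
  -- Averaging the lift `q` of the old frame gives, after normalization, a continuous lift of the
  -- new one.
  set w : I → ℍ[ℝ] := fun t => intertwiner (quatVec (γ'.pos t)) (quatVec (γ'.tangent t)) (q t)
    with hw
  have hw0 : ∀ t, w t ≠ 0 := fun t => intertwiner_ne_zero (hq t) (a0 t) (a1 t) (hclose t)
  have hwc : Continuous w := by
    have c1 : Continuous fun t => quatVec (γ'.pos t) := continuous_quatVec.comp γ'.pos.continuous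
    have c2 : Continuous fun t => quatVec (γ'.tangent t) :=
      continuous_quatVec.comp (continuous_tangent h')
    have c3 := q.continuous
    simp only [hw, intertwiner]
    fun_prop
  -- Where the two frames agree, as they do at both ends, the new lift equals the old one, so the
  -- final value `ε` is kept.
  have hend : ∀ t, γ'.pos t = γ.pos t → γ'.tangent t = γ.tangent t → ‖w t‖⁻¹ • w t = q t := by
    intro t e1 e2
    have e3 : w t = (4 : ℝ) • q t := by
      rw [hw]
      simp only
      rw [e1, e2, intertwiner_of_frame (a0 t) (a1 t), ← Quaternion.coe_mul_eq_smul]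
      norm_cast
    rw [e3, norm_smul, hq t, smul_smul]
    norm_num
  have hn : ∀ t, ‖‖w t‖⁻¹ • w t‖ = 1 := fun t => by
    rw [norm_smul, norm_inv, norm_norm, inv_mul_cancel₀ (norm_ne_zero_iff.2 (hw0 t))]
  refine ⟨h', ⟨fun t => ‖w t‖⁻¹ • w t, (hwc.norm.inv₀ fun t => norm_ne_zero_iff.2 (hw0 t)).smul
    hwc⟩, hn, fun t => ?_, ?_, ?_⟩
  · have b0 : (‖w t‖⁻¹ • w t) * quatUnit 0 = quatVec (γ'.pos t) * (‖w t‖⁻¹ • w t) := by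
      rw [smul_mul_assoc, mul_smul_comm]
      exact congrArg _ (intertwiner_mul_zero (quatVec_sq (h'.1 t)) _)
    have b1 : (‖w t‖⁻¹ • w t) * quatUnit 1 = quatVec (γ'.tangent t) * (‖w t‖⁻¹ • w t) := by
      rw [smul_mul_assoc, mul_smul_comm]
      exact congrArg _ (intertwiner_mul_one (quatVec_sq (norm_tangent h' t))
        (quatVec_mul_comm (inner_pos_tangent h' t)) _)
    have b2 : (‖w t‖⁻¹ • w t) * quatUnit 2
        = quatVec (cross (γ'.pos t) (γ'.tangent t)) * (‖w t‖⁻¹ • w t) := by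
      rw [← quatVec_mul (inner_pos_tangent h' t), ← quatUnit_zero_mul_one, ← mul_assoc, b0,
        mul_assoc, b1, mul_assoc]
    ext j i
    fin_cases i
    · exact proj_of_mul_quatUnit_eq (hn t) b0 j
    · exact proj_of_mul_quatUnit_eq (hn t) b1 j
    · exact proj_of_mul_quatUnit_eq (hn t) b2 j
  · refine (hend 0 ?_ ?_).trans q0
    · rw [h'.2.2.1, hγ.2.2.1]
    · rw [tangent_zero h', tangent_zero hγ]
  · refine (hend 1 ?_ ?_).trans q1
    · rw [h'.2.2.2.1, hγ.2.2.2.1]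
    · rw [tangent_one h', tangent_one hγ]

/-- The sign is constant along paths of immersions. -/
theorem mem_immersionsSign_of_path {ε : ℤˣ} {f : I → H2Curve} (hc : Continuous f)
    (hf : ∀ s, f s ∈ Immersions) (h0 : f 0 ∈ ImmersionsSign ε) (s : I) :
    f s ∈ ImmersionsSign ε := by
  have hA : Continuous fun x : I × I => quatVec ((f x.1).pos x.2) :=
    continuous_quatVec.comp (continuous_uncurry_pos hc)
  have hB : Continuous fun x : I × I => quatVec ((f x.1).tangent x.2) :=
    continuous_quatVec.comp (continuous_uncurry_tangent hc hf)
  have key : ∀ s₀ : I, ∀ᶠ s in nhds s₀, ∀ t ∈ (Set.univ : Set I),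
      ‖quatVec ((f s).pos t) - quatVec ((f s₀).pos t)‖
      + ‖quatVec ((f s).tangent t) - quatVec ((f s₀).tangent t)‖
      + ‖quatVec ((f s).pos t) * quatVec ((f s).tangent t)
        - quatVec ((f s₀).pos t) * quatVec ((f s₀).tangent t)‖ < 4 := by
    intro s₀
    refine isCompact_univ.eventually_forall_of_forall_eventually fun t _ => ?_
    have hA' := hA.comp (by fun_prop : Continuous fun x : I × I => (s₀, x.2))
    have hB' := hB.comp (by fun_prop : Continuous fun x : I × I => (s₀, x.2))
    have c := (((hA.sub hA').norm.add (hB.sub hB').norm).add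
      ((hA.mul hB).sub (hA'.mul hB')).norm)
    refine c.continuousAt.eventually_lt continuousAt_const ?_
    simp
  -- Closeness of frames is symmetric, so the sign passes from `s` to `s₀` as well as from `s₀` to
  -- `s`.
  have hclopen : IsClopen {s | f s ∈ ImmersionsSign ε} := by
    constructor
    · rw [← isOpen_compl_iff, isOpen_iff_mem_nhds]
      intro s₀ hs₀
      filter_upwards [key s₀] with s hs hmem
      refine hs₀ (mem_immersionsSign_of_close hmem (hf s₀) fun t => ?_)
      simpa only [norm_sub_rev] using hs t trivial
    · rw [isOpen_iff_mem_nhds]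
      intro s₀ hs₀
      filter_upwards [key s₀] with s hs
      exact mem_immersionsSign_of_close hs₀ (hf s) fun t => hs t trivial
  have := hclopen.eq_univ ⟨0, h0⟩
  exact Set.eq_univ_iff_forall.1 this s

end H2Curve

/-- The cross product as a continuous bilinear map. -/
def crossL : E3 →L[ℝ] E3 →L[ℝ] E3 :=
  (LinearMap.mk₂ ℝ cross
    (fun a b c => by
      apply E3_ext <;> simp only [cross_apply_zero, cross_apply_one, cross_apply_two,
        PiLp.add_apply] <;> ring)
    (fun a b c => by
      apply E3_ext <;> simp only [cross_apply_zero, cross_apply_one, cross_apply_two,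
        PiLp.smul_apply, smul_eq_mul] <;> ring)
    (fun a b c => by
      apply E3_ext <;> simp only [cross_apply_zero, cross_apply_one, cross_apply_two,
        PiLp.add_apply] <;> ring)
    (fun a b c => by
      apply E3_ext <;> simp only [cross_apply_zero, cross_apply_one, cross_apply_two,
        PiLp.smul_apply, smul_eq_mul] <;> ring)).toContinuousBilinearMap

theorem crossL_apply (a b : E3) : crossL a b = cross a b := rfl

theorem _root_.Continuous.cross {X : Type*} [TopologicalSpace X] {f g : X → E3}
    (hf : Continuous f) (hg : Continuous g) : Continuous fun x => LittleSpaces.cross (f x) (g x) :=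
  (crossL.continuous.comp hf).clm_apply hg

theorem _root_.HasDerivAt.cross {f g : ℝ → E3} {f' g' : E3} {t : ℝ} (hf : HasDerivAt f f' t)
    (hg : HasDerivAt g g' t) : HasDerivAt (fun t => LittleSpaces.cross (f t) (g t))
      (LittleSpaces.cross f' (g t) + LittleSpaces.cross (f t) g') t :=
  (crossL.hasFDerivAt.comp_hasDerivAt t hf).clm_apply hg

/-- A continuous family of curves of class `C³`, with their first three derivatives. -/
structure C3Family (X : Type*) [TopologicalSpace X] extends C2Family X where
  /-- the third derivatives -/
  jerk : X → ℝ → E3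
  continuous_jerk : Continuous fun x : X × ℝ => jerk x.1 x.2
  hasDerivAt_acc : ∀ x t, HasDerivAt (acc x) (jerk x t) t

/-! ### Smooth approximation of compact families. -/

section Bernstein

variable {K : Type*} [TopologicalSpace K] {n : ℕ}

/-- A polynomial combination of functions on `K`. -/
def polySum (p : Fin (n + 1) → Polynomial ℝ) (c : Fin (n + 1) → C(K, E3)) (k : K) (t : ℝ) : E3 :=
  ∑ j, (p j).eval t • c j k

theorem continuous_polySum (p : Fin (n + 1) → Polynomial ℝ) (c : Fin (n + 1) → C(K, E3)) :
    Continuous fun x : K × ℝ => polySum p c x.1 x.2 :=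
  continuous_finsetSum _ fun j _ => ((p j).continuous.comp continuous_snd).smul
    ((c j).continuous.comp continuous_fst)

theorem hasDerivAt_polySum (p : Fin (n + 1) → Polynomial ℝ) (c : Fin (n + 1) → C(K, E3)) (k : K)
    (t : ℝ) : HasDerivAt (polySum p c k) (polySum (fun j => (p j).derivative) c k t) t :=
  HasDerivAt.fun_sum fun j _ => ((p j).hasDerivAt t).smul_const (c j k)

/-- The curve with derivative `polySum p c k t + 6 t (1 - t) • m k`. -/
def bumpFamily (p : Fin (n + 1) → Polynomial ℝ) (c : Fin (n + 1) → C(K, E3)) (m : C(K, E3)) :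
    C3Family K where
  pos k t := e 0 + ∫ s in (0 : ℝ)..t, (polySum p c k s + (6 * s * (1 - s)) • m k)
  vel k t := polySum p c k t + (6 * t * (1 - t)) • m k
  acc k t := polySum (fun j => (p j).derivative) c k t + (6 - 12 * t) • m k
  jerk k t := polySum (fun j => (p j).derivative.derivative) c k t + (-12 : ℝ) • m k
  continuous_pos := by
    refine continuous_const.add ?_
    refine intervalIntegral.continuous_parametric_intervalIntegral_of_continuous
      (f := fun (x : K × ℝ) s => polySum p c x.1 s + (6 * s * (1 - s)) • m x.1) ?_ continuous_snd
    have := (continuous_polySum p c).comp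
      (by fun_prop : Continuous fun x : (K × ℝ) × ℝ => (x.1.1, x.2))
    simp only [Function.comp_def] at this
    simp only [Function.uncurry_def]
    fun_prop
  continuous_vel := by have := continuous_polySum p c; fun_prop
  continuous_acc := by have := continuous_polySum (fun j => (p j).derivative) c; fun_prop
  continuous_jerk := by
    have := continuous_polySum (fun j => (p j).derivative.derivative) c; fun_prop
  hasDerivAt_pos k t := by
    have h : Continuous fun s => polySum p c k s + (6 * s * (1 - s)) • m k := by
      have := (continuous_polySum p c).comp (by fun_prop : Continuous fun x : ℝ => (k, x))
      simp only [Function.comp_def] at this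
      fun_prop
    exact (h.integral_hasStrictDerivAt 0 t).hasDerivAt.const_add (e 0)
  hasDerivAt_vel k t := by
    refine (hasDerivAt_polySum p c k t).add (HasDerivAt.smul_const ?_ (m k))
    have := ((hasDerivAt_id t).const_mul 6).mul ((hasDerivAt_id t).const_sub 1)
    refine this.congr_deriv ?_
    simp only [id]
    ring
  hasDerivAt_acc k t := by
    refine (hasDerivAt_polySum _ c k t).add (HasDerivAt.smul_const ?_ (m k))
    have := ((hasDerivAt_id t).const_mul 12).const_sub 6
    refine this.congr_deriv ?_
    ring

variable [CompactSpace K]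

/-- Smooth approximation in `C¹` of a compact family of curves, with the same endpoint data. -/
theorem exists_C3Family_close {f : K → H2Curve} (hf : Continuous f)
    (him : ∀ k, f k ∈ Immersions) {δ : ℝ} (hδ : 0 < δ) :
    ∃ η : C3Family K, (∀ k, η.pos k 0 = e 0 ∧ η.pos k 1 = e 0 ∧ η.vel k 0 = e 1 ∧ η.vel k 1 = e 1) ∧
      ∀ (k : K) (t : I), ‖η.pos k t - (f k).pos t‖ < δ ∧ ‖η.vel k t - (f k).vel t‖ < δ := by
  -- Treating all velocities as one curve in `C(K, E3)` makes the Bernstein approximation uniform in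
  -- `k`, with coefficients continuous in `k`.
  let V : C(I, C(K, E3)) := ContinuousMap.curry ⟨fun x : I × K => (f x.2).vel x.1,
    (H2Curve.continuous_uncurry_vel hf).comp continuous_swap⟩
  have hV : ∀ t k, V t k = (f k).vel t := fun t k => rfl
  have hδ3 : 0 < δ / 3 := by positivity
  obtain ⟨n, hn, hn0⟩ := ((Metric.tendstoUniformly_iff.1 (ContinuousMap.tendsto_iff_tendstoUniformly.1
    (bernsteinApproximation_uniform V)) (δ / 3) hδ3).and (Filter.eventually_ne_atTop 0)).exists
  set p : Fin (n + 1) → Polynomial ℝ := fun j => bernsteinPolynomial ℝ n j with hp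
  set c : Fin (n + 1) → C(K, E3) := fun j => V (bernstein.z j) with hc
  have hpoly : ∀ (t : I) k, polySum p c k t = bernsteinApproximation n V t k := by
    intro t k
    rw [bernsteinApproximation.apply, ContinuousMap.sum_apply]
    rfl
  have hclose : ∀ (t : I) k, ‖polySum p c k t - (f k).vel t‖ < δ / 3 := by
    intro t k
    rw [hpoly, ← hV, ← ContinuousMap.sub_apply]
    have h1 := hn t
    rw [dist_comm, dist_eq_norm] at h1
    exact (ContinuousMap.norm_coe_le_norm _ k).trans_lt h1
  have hcont := continuous_polySum p c
  have hmc : Continuous fun k => -∫ s in (0 : ℝ)..1, polySum p c k s :=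
    (intervalIntegral.continuous_parametric_intervalIntegral_of_continuous hcont
      continuous_const).neg
  have hcontk : ∀ k, Continuous fun s => polySum p c k s := fun k =>
    hcont.comp (by fun_prop : Continuous fun s : ℝ => (k, s))
  have hvelk : ∀ k, Continuous fun s : ℝ => (f k).vel (Set.projIcc 0 1 zero_le_one s) := fun k =>
    (f k).vel.continuous.comp continuous_projIcc
  -- `m` closes the curve up: `6 s (1 - s)` has integral `1` and vanishes at both ends, where the
  -- Bernstein polynomials already have the right values.
  set m : C(K, E3) := ⟨_, hmc⟩ with hm
  have hmk : ∀ k, m k = -∫ s in (0 : ℝ)..1, polySum p c k s := fun k => rfl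
  have hpos : ∀ k (t : I), (f k).pos t
      = e 0 + ∫ s in (0 : ℝ)..t, (f k).vel (Set.projIcc 0 1 zero_le_one s) := by
    intro k t
    rw [intervalIntegral_projIcc, ← (him k).2.2.1]
    exact (f k).pos_eq t
  have hbound : ∀ k, ‖m k‖ ≤ δ / 3 := by
    intro k
    have h1 := hpos k 1
    rw [(him k).2.2.2.1, left_eq_add, Set.Icc.coe_one] at h1
    rw [hmk, norm_neg, ← sub_zero (∫ s in (0 : ℝ)..1, polySum p c k s), ← h1,
      ← intervalIntegral.integral_sub ((hcontk k).intervalIntegrable _ _)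
        ((hvelk k).intervalIntegrable _ _)]
    have := intervalIntegral.norm_integral_le_of_norm_le_const (a := (0 : ℝ)) (b := 1) (C := δ / 3)
      (f := fun s => polySum p c k s - (f k).vel (Set.projIcc 0 1 zero_le_one s)) ?_
    · simpa using this
    · intro s hs
      rw [Set.uIoc_of_le zero_le_one] at hs
      have hs' : s ∈ I := ⟨hs.1.le, hs.2⟩
      rw [Set.projIcc_of_mem _ hs']
      exact (hclose ⟨s, hs'⟩ k).le
  -- `3 / 2` is the maximum of `6 t (1 - t)`; the total is `5 δ / 6`.
  have hvel : ∀ k (t : I), ‖(bumpFamily p c m).vel k t - (f k).vel t‖ ≤ δ / 3 + 3 / 2 * (δ / 3) := by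
    intro k t
    have e1 : (bumpFamily p c m).vel k t - (f k).vel t
        = (polySum p c k t - (f k).vel t) + (6 * (t : ℝ) * (1 - t)) • m k := by
      show polySum p c k t + (6 * (t : ℝ) * (1 - t)) • m k - (f k).vel t = _
      abel
    rw [e1]
    refine (norm_add_le _ _).trans (add_le_add (hclose t k).le ?_)
    rw [norm_smul]
    have ht := t.2
    have h0 : 0 ≤ 6 * (t : ℝ) * (1 - t) :=
      mul_nonneg (mul_nonneg (by norm_num) ht.1) (by linarith [ht.2])
    rw [Real.norm_of_nonneg h0]
    exact mul_le_mul (by nlinarith [sq_nonneg ((t : ℝ) - 1 / 2)]) (hbound k) (norm_nonneg _)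
      (by norm_num)
  refine ⟨bumpFamily p c m, fun k => ⟨?_, ?_, ?_, ?_⟩, fun k t => ⟨?_, ?_⟩⟩
  · simp [bumpFamily]
  · show e 0 + ∫ s in (0 : ℝ)..1, (polySum p c k s + (6 * s * (1 - s)) • m k) = e 0
    rw [intervalIntegral.integral_add ((hcontk k).intervalIntegrable _ _)
      (Continuous.intervalIntegrable (by fun_prop) _ _), intervalIntegral.integral_smul_const]
    have : ∫ s in (0 : ℝ)..1, 6 * s * (1 - s) = 1 := by
      have hd : ∀ s ∈ Set.uIcc (0 : ℝ) 1, HasDerivAt (fun s : ℝ => 3 * s ^ 2 - 2 * s ^ 3)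
          (6 * s * (1 - s)) s := by
        intro s _
        refine (((hasDerivAt_pow 2 s).const_mul 3).sub
          ((hasDerivAt_pow 3 s).const_mul 2)).congr_deriv ?_
        norm_num
        ring
      rw [intervalIntegral.integral_eq_sub_of_hasDerivAt hd
        (Continuous.intervalIntegrable (by fun_prop) _ _)]
      norm_num
    rw [this, one_smul, hmk]
    simp
  · show polySum p c k 0 + (6 * (0 : ℝ) * (1 - 0)) • m k = e 1
    have := hpoly 0 k
    rw [Set.Icc.coe_zero] at this
    rw [this, bernsteinApproximation.apply_zero, hV, (him k).2.2.2.2.1]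
    simp
  · show polySum p c k 1 + (6 * (1 : ℝ) * (1 - 1)) • m k = e 1
    have := hpoly 1 k
    rw [Set.Icc.coe_one] at this
    rw [this, bernsteinApproximation.apply_one hn0, hV, (him k).2.2.2.2.2]
    simp
  · rw [hpos k t]
    show ‖e 0 + (∫ s in (0 : ℝ)..t, (bumpFamily p c m).vel k s) - _‖ < δ
    have hv : Continuous fun s => (bumpFamily p c m).vel k s :=
      (bumpFamily p c m).continuous_vel.comp (by fun_prop : Continuous fun s : ℝ => (k, s))
    rw [add_sub_add_left_eq_sub, ← intervalIntegral.integral_sub (hv.intervalIntegrable _ _)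
      ((hvelk k).intervalIntegrable _ _)]
    have := intervalIntegral.norm_integral_le_of_norm_le_const (a := (0 : ℝ)) (b := t)
      (C := δ / 3 + 3 / 2 * (δ / 3))
      (f := fun s => (bumpFamily p c m).vel k s - (f k).vel (Set.projIcc 0 1 zero_le_one s)) ?_
    · refine this.trans_lt ?_
      rw [sub_zero, abs_of_nonneg t.2.1]
      nlinarith [t.2.2, t.2.1]
    · intro s hs
      rw [Set.uIoc_of_le t.2.1] at hs
      have hs' : s ∈ I := ⟨hs.1.le, hs.2.trans t.2.2⟩
      rw [Set.projIcc_of_mem _ hs']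
      exact hvel k ⟨s, hs'⟩
  · exact (hvel k t).trans_lt (by linarith)

end Bernstein

/-! ### Segments between curves. -/

namespace H2Curve

/-- The segment between two curves. -/
def lerp (s : ℝ) (γ γ' : H2Curve) : H2Curve where
  pos := γ.pos + s • (γ'.pos - γ.pos)
  vel := γ.vel + s • (γ'.vel - γ.vel)
  acc := γ.acc + s • (γ'.acc - γ.acc)
  pos_eq t := by
    simp only [← setIntegralLp_toLp, map_add, map_smul, map_sub]
    simp only [setIntegralLp_toLp, ContinuousMap.add_apply, ContinuousMap.smul_apply,
      ContinuousMap.sub_apply, γ.pos_eq t, γ'.pos_eq t]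
    module
  vel_eq t := by
    simp only [← setIntegralLp_apply, map_add, map_smul, map_sub]
    simp only [setIntegralLp_apply, ContinuousMap.add_apply, ContinuousMap.smul_apply,
      ContinuousMap.sub_apply, γ.vel_eq t, γ'.vel_eq t]
    module

theorem continuous_lerp {X : Type*} [TopologicalSpace X] {s : X → ℝ} {f g : X → H2Curve}
    (hs : Continuous s) (hf : Continuous f) (hg : Continuous g) :
    Continuous fun x => lerp (s x) (f x) (g x) := by
  have a := continuous_iff.1 hf
  have b := continuous_iff.1 hg
  exact continuous_iff.2 ⟨a.1.add (hs.smul (b.1.sub a.1)), a.2.1.add (hs.smul (b.2.1.sub a.2.1)),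
    a.2.2.add (hs.smul (b.2.2.sub a.2.2))⟩

theorem lerp_zero (γ γ' : H2Curve) : lerp 0 γ γ' = γ :=
  eq_of_pos_eq (ContinuousMap.ext fun t => by simp [lerp])

theorem lerp_one (γ γ' : H2Curve) : lerp 1 γ γ' = γ' :=
  eq_of_pos_eq (ContinuousMap.ext fun t => by simp [lerp])

end H2Curve

/-- The pairs `(γ, γ')` fill a compact set inside the open set where the cross product is nonzero. A
`C¹`-close curve, and with it the whole segment, stays in a thickening of that compact set. -/
theorem exists_C3Family_regular {K : Type*} [TopologicalSpace K] [CompactSpace K]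
    {f : K → H2Curve} (hf : Continuous f) (him : ∀ k, f k ∈ Immersions) :
    ∃ η : C3Family K, ∀ (s : I) (k : K), (H2Curve.lerp s (f k) (η.curve k)).Regular := by
  let φ : K × I → E3 × E3 := fun x => ((f x.1).pos x.2, (f x.1).vel x.2)
  have hφ : Continuous φ :=
    (H2Curve.continuous_uncurry_pos hf).prodMk (H2Curve.continuous_uncurry_vel hf)
  have hU : IsOpen {x : E3 × E3 | cross x.1 x.2 ≠ 0} :=
    isOpen_ne.preimage (continuous_fst.cross continuous_snd)
  obtain ⟨δ, hδ, hsub⟩ := (isCompact_range hφ).exists_thickening_subset_open hU (by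
    rintro _ ⟨x, rfl⟩
    exact (H2Curve.regular_of_mem_immersions (him x.1)).cross_ne_zero x.2)
  obtain ⟨η, hend, hclose⟩ := exists_C3Family_close hf him hδ
  refine ⟨η, fun s k => ?_⟩
  have hi := him k
  obtain ⟨e1, e2, e3, e4⟩ := hend k
  have hs : |(s : ℝ)| ≤ 1 := abs_le.2 ⟨by linarith [s.2.1], s.2.2⟩
  have hsm : ∀ v : E3, ‖v‖ < δ → ‖(s : ℝ) • v‖ < δ := fun v hv => by
    rw [norm_smul, Real.norm_eq_abs]
    exact (mul_le_of_le_one_left (norm_nonneg v) hs).trans_lt hv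
  have h1 : (η.curve k).pos 0 = e 0 := e1
  have h2 : (η.curve k).pos 1 = e 0 := e2
  have h3 : (η.curve k).vel 0 = e 1 := e3
  have h4 : (η.curve k).vel 1 = e 1 := e4
  refine ⟨fun t => ?_, ?_, ?_, ?_, ?_⟩
  · have hmem : ((H2Curve.lerp s (f k) (η.curve k)).pos t,
        (H2Curve.lerp s (f k) (η.curve k)).vel t) ∈ Metric.thickening δ (Set.range φ) := by
      refine Metric.mem_thickening_iff.2 ⟨φ (k, t), ⟨_, rfl⟩, ?_⟩
      rw [Prod.dist_eq, dist_eq_norm, dist_eq_norm]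
      refine max_lt ?_ ?_
      · have h5 := hsm _ (hclose k t).1
        rw [← C2Family.curve_pos] at h5
        simpa [φ, H2Curve.lerp] using h5
      · have h5 := hsm _ (hclose k t).2
        rw [← C2Family.curve_vel] at h5
        simpa [φ, H2Curve.lerp] using h5
    exact hsub hmem
  · simp [H2Curve.lerp, h1, hi.2.2.1]
  · simp [H2Curve.lerp, h2, hi.2.2.2.1]
  · simp [H2Curve.lerp, h3, hi.2.2.2.2.1]
  · simp [H2Curve.lerp, h4, hi.2.2.2.2.2]

/-! ### A family of closed curves in the sphere

For `s ∈ (0, 1]` the vector `(loopA, s * loopB, s * loopG)` runs, up to a positive factor, through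
an immersed closed curve in the sphere: a small figure eight for `s` near `0`, and a locally convex
curve for `s = 1`. The variables `C`, `S` stand for the cosine and the sine of the parameter. -/

/-- The parameter of the pencil of curves. -/
def loopM (s : ℝ) : ℝ := 1 - 5 / 8 * s

/-- Let `m = loopM s`, `z = C + i S` on the unit circle, `p = (1 - m) C + m + i m S`, `v = |p|²` and
`u = s² (1 - C) / 128`. Then `loopA = v - u` and `8 (loopB + i loopG) = i (1 - z) p`, whence `s²
(loopB² + loopG²) = 4 u v`. So the vector has norm `u + v`, and its direction is the inverse
stereographic projection of `s (loopB + i loopG) / (2 v)`. For `s` in `[0,1]`, `p` vanishes only at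
`z = -1`, `s = 4/5`, where the curve crosses the antipodal point. -/
def loopA (s C : ℝ) : ℝ :=
  (1 - 2 * loopM s) * C ^ 2 + (2 * loopM s * (1 - loopM s) + s ^ 2 / 128) * C
    + (2 * loopM s ^ 2 - s ^ 2 / 128)
def loopA₁ (s C S : ℝ) : ℝ :=
  -(S * (2 * (1 - 2 * loopM s) * C + (2 * loopM s * (1 - loopM s) + s ^ 2 / 128)))
def loopA₂ (s C : ℝ) : ℝ :=
  -(C * (2 * (1 - 2 * loopM s) * C + (2 * loopM s * (1 - loopM s) + s ^ 2 / 128)))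
    + 2 * (1 - 2 * loopM s) * (1 - C ^ 2)
def loopB (C S : ℝ) : ℝ := S * C / 8
def loopB₁ (C : ℝ) : ℝ := (2 * C ^ 2 - 1) / 8
def loopB₂ (C S : ℝ) : ℝ := -(S * C / 2)
def loopG (s C : ℝ) : ℝ := (2 * loopM s + (1 - 2 * loopM s) * C - C ^ 2) / 8
def loopG₁ (s C S : ℝ) : ℝ := S * (2 * C - (1 - 2 * loopM s)) / 8
def loopG₂ (s C : ℝ) : ℝ := (C * (2 * C - (1 - 2 * loopM s)) - 2 * (1 - C ^ 2)) / 8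

section LoopDerivatives

open Real

theorem hasDerivAt_loopA (s τ : ℝ) :
    HasDerivAt (fun τ => loopA s (cos τ)) (loopA₁ s (cos τ) (sin τ)) τ := by
  have h := ((((hasDerivAt_cos τ).pow 2).const_mul (1 - 2 * loopM s)).add
    ((hasDerivAt_cos τ).const_mul (2 * loopM s * (1 - loopM s) + s ^ 2 / 128))).add_const
    (2 * loopM s ^ 2 - s ^ 2 / 128)
  refine h.congr_deriv ?_
  simp only [loopA₁]; push_cast; ring

theorem hasDerivAt_loopA₁ (s τ : ℝ) :
    HasDerivAt (fun τ => loopA₁ s (cos τ) (sin τ)) (loopA₂ s (cos τ)) τ := by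
  have h := ((hasDerivAt_sin τ).mul (((hasDerivAt_cos τ).const_mul
    (2 * (1 - 2 * loopM s))).add_const
    (2 * loopM s * (1 - loopM s) + s ^ 2 / 128))).neg
  refine h.congr_deriv ?_
  simp only [loopA₂, ← Real.sin_sq]; ring

theorem hasDerivAt_loopB (τ : ℝ) :
    HasDerivAt (fun τ => loopB (cos τ) (sin τ)) (loopB₁ (cos τ)) τ := by
  refine (((hasDerivAt_sin τ).mul (hasDerivAt_cos τ)).div_const 8).congr_deriv ?_
  simp only [loopB₁]
  linear_combination (-1 / 8) * sin_sq_add_cos_sq τ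

theorem hasDerivAt_loopB₁ (τ : ℝ) :
    HasDerivAt (fun τ => loopB₁ (cos τ)) (loopB₂ (cos τ) (sin τ)) τ := by
  refine (((((hasDerivAt_cos τ).pow 2).const_mul 2).sub_const 1).div_const 8).congr_deriv ?_
  simp only [loopB₂]; push_cast; ring

theorem hasDerivAt_loopG (s τ : ℝ) :
    HasDerivAt (fun τ => loopG s (cos τ)) (loopG₁ s (cos τ) (sin τ)) τ := by
  refine (((((hasDerivAt_cos τ).const_mul (1 - 2 * loopM s)).const_add
    (2 * loopM s)).sub ((hasDerivAt_cos τ).pow 2)).div_const 8).congr_deriv ?_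
  simp only [loopG₁]; push_cast; ring

theorem hasDerivAt_loopG₁ (s τ : ℝ) :
    HasDerivAt (fun τ => loopG₁ s (cos τ) (sin τ)) (loopG₂ s (cos τ)) τ := by
  refine (((hasDerivAt_sin τ).mul (((hasDerivAt_cos τ).const_mul 2).sub_const
    (1 - 2 * loopM s))).div_const 8).congr_deriv ?_
  simp only [loopG₂, ← Real.sin_sq]; ring

end LoopDerivatives

/-- The curves of the family with `s > 0` are immersed. -/
theorem loop_minors_ne_zero {s C S : ℝ} (hs : 0 < s) (h : C ^ 2 + S ^ 2 = 1)
    (h₁ : loopA s C * loopB₁ C - loopA₁ s C S * loopB C S = 0)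
    (h₂ : loopA s C * loopG₁ s C S - loopA₁ s C S * loopG s C = 0)
    (h₃ : loopB C S * loopG₁ s C S - loopB₁ C * loopG s C = 0) : False := by
  set m := loopM s with hm
  set v := ((1 - m) * C + m) ^ 2 + m ^ 2 * (1 - C ^ 2) with hv
  set u := s ^ 2 / 128 * (1 - C) with hu
  -- The left side is `64` times the sum of the squares of the three minors, the third one weighted
  -- by `s ^ 2`.
  have key : (v + u) ^ 2 * (2 - C ^ 2) = 0 := by
    have e₁ : (loopA s C * (2 * C ^ 2 - 1) + (1 - C ^ 2) * C * (2 * (1 - 2 * m) * C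
        + (2 * m * (1 - m) + s ^ 2 / 128))) = 0 := by
      simp only [loopA₁, loopB₁, loopB] at h₁
      linear_combination 8 * h₁ - C * (2 * (1 - 2 * m) * C
        + (2 * m * (1 - m) + s ^ 2 / 128)) * h
    have e₂ : S * (loopA s C * (2 * C - (1 - 2 * m)) + (2 * (1 - 2 * m) * C
        + (2 * m * (1 - m) + s ^ 2 / 128)) * (2 * m + (1 - 2 * m) * C - C ^ 2)) = 0 := by
      simp only [loopA₁, loopG₁, loopG] at h₂
      linear_combination 8 * h₂
    have e₃ : (1 - C ^ 2) * C * (2 * C - (1 - 2 * m))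
        - (2 * C ^ 2 - 1) * (2 * m + (1 - 2 * m) * C - C ^ 2) = 0 := by
      simp only [loopB₁, loopB, loopG₁, loopG] at h₃
      linear_combination 64 * h₃ - C * (2 * C - (1 - 2 * m)) * h
    have e₂' : (1 - C ^ 2) * (loopA s C * (2 * C - (1 - 2 * m)) + (2 * (1 - 2 * m) * C
        + (2 * m * (1 - m) + s ^ 2 / 128)) * (2 * m + (1 - 2 * m) * C - C ^ 2)) ^ 2 = 0 := by
      rw [show 1 - C ^ 2 = S ^ 2 by linarith, ← mul_pow, e₂]; norm_num
    have e₁' := congrArg (· ^ 2) e₁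
    have e₃' := congrArg (· ^ 2) e₃
    simp only [loopA, ← hm] at e₁' e₂'
    rw [hv, hu]
    linear_combination e₁' + e₂' + s ^ 2 / 64 * e₃'
  have hC : C ^ 2 ≤ 1 := by nlinarith [sq_nonneg S]
  have hC1 : C ≤ 1 := by nlinarith
  have hv0 : 0 ≤ v := by
    have : 0 ≤ m ^ 2 * (1 - C ^ 2) := mul_nonneg (sq_nonneg m) (by linarith)
    positivity
  have hu0 : 0 ≤ u := mul_nonneg (by positivity) (by linarith)
  -- Both summands are nonnegative. The vanishing of `u` forces `C = 1`, where `v = 1`.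
  have hz : v + u = 0 := by
    rcases mul_eq_zero.1 key with h0 | h0
    · exact pow_eq_zero_iff two_ne_zero |>.1 h0
    · linarith
  have hu1 : u = 0 := by linarith
  have hv1 : v = 0 := by linarith
  have hC2 : C = 1 := by
    rcases mul_eq_zero.1 hu1 with h0 | h0
    · have : 0 < s ^ 2 / 128 := by positivity
      linarith
    · linarith
  rw [hv, hC2] at hv1
  norm_num at hv1

/-- The infinitesimal figure eight never points backwards. -/
theorem loop_zero_ne_zero {l C S : ℝ} (hl : 0 ≤ l) (hl' : l ≤ 1) (h : C ^ 2 + S ^ 2 = 1)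
    (h₁ : l * loopA 0 C ^ 2 + (1 - l) * (loopA 0 C * loopB₁ C - loopA₁ 0 C S * loopB C S) = 0)
    (h₂ : (1 - l) * (loopA 0 C * loopG₁ 0 C S - loopA₁ 0 C S * loopG 0 C) = 0) : False := by
  have hA : loopA 0 C = 2 - C ^ 2 := by simp only [loopA, loopM]; ring
  have hC : C ^ 2 ≤ 1 := by nlinarith [sq_nonneg S]
  -- The transversal part vanishes only for `l = 1` or `S = 0`. The forward part is `(2 - C²)²` in
  -- the first case and `l + (1 - l) / 8` in the second, both positive.
  have e₂ : (1 - l) * (S * (2 + C ^ 2)) = 0 := by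
    simp only [hA, loopA₁, loopG₁, loopG, loopM] at h₂
    linear_combination 8 * h₂
  have e₁ : l * (2 - C ^ 2) ^ 2 + (1 - l) * ((3 * C ^ 2 - 2) / 8) = 0 := by
    simp only [hA, loopA₁, loopB₁, loopB, loopM] at h₁
    linear_combination h₁ + (1 - l) * (C ^ 2 / 4) * h
  rcases mul_eq_zero.1 e₂ with h0 | h0
  · have : l = 1 := by linarith
    rw [this] at e₁
    nlinarith
  · rcases mul_eq_zero.1 h0 with h0 | h0
    · have : C ^ 2 = 1 := by rw [h0] at h; linarith
      rw [this] at e₁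
      linarith
    · nlinarith [sq_nonneg C]

/-- The curve with `s = 1` is locally convex. -/
theorem loop_det_pos {C S : ℝ} (h : C ^ 2 + S ^ 2 = 1) :
    0 < loopA 1 C * (loopB₁ C * loopG₂ 1 C - loopG₁ 1 C S * loopB₂ C S)
      - loopB C S * (loopA₁ 1 C S * loopG₂ 1 C - loopG₁ 1 C S * loopA₂ 1 C)
      + loopG 1 C * (loopA₁ 1 C S * loopB₂ C S - loopB₁ C * loopA₂ 1 C) := by
  have hC : C ^ 2 ≤ 1 := by nlinarith [sq_nonneg S]
  have hC1 : C ≤ 1 := by nlinarith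
  have hC2 : -1 ≤ C := by nlinarith
  have hS : S ^ 2 = 1 - C ^ 2 := by linarith
  -- The cubic is increasing on `[-1, 1]`, with minimum `12 / 8192` at `C = -1`.
  have e : loopA 1 C * (loopB₁ C * loopG₂ 1 C - loopG₁ 1 C S * loopB₂ C S)
      - loopB C S * (loopA₁ 1 C S * loopG₂ 1 C - loopG₁ 1 C S * loopA₂ 1 C)
      + loopG 1 C * (loopA₁ 1 C S * loopB₂ C S - loopB₁ C * loopA₂ 1 C)
      = (118 + 111 * C - 5 * C ^ 3) / 8192 := by
    simp only [loopA, loopA₁, loopA₂, loopB, loopB₁, loopB₂, loopG, loopG₁, loopG₂, loopM]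
    ring_nf
    rw [hS]
    ring
  rw [e]
  nlinarith [mul_nonneg (sub_nonneg.2 hC1) (by linarith : 0 ≤ C + 1)]

/-! ### Fast loops along a family of curves. -/

namespace C3Family

variable {K : Type*} [TopologicalSpace K] (η : C3Family K)

/-- The combination of `η`, `η'`, `η × η'` with coefficients `a`, `b`, `c`. -/
def frame (k : K) (a b c t : ℝ) : E3 :=
  a • η.pos k t + b • η.vel k t + c • cross (η.pos k t) (η.vel k t)

/-- The combination of the derivatives of `η`, `η'`, `η × η'`. -/
def frame₁ (k : K) (a b c t : ℝ) : E3 :=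
  a • η.vel k t + b • η.acc k t + c • cross (η.pos k t) (η.acc k t)

/-- The combination of the second derivatives of `η`, `η'`, `η × η'`. -/
def frame₂ (k : K) (a b c t : ℝ) : E3 :=
  a • η.acc k t + b • η.jerk k t
    + c • (cross (η.vel k t) (η.acc k t) + cross (η.pos k t) (η.jerk k t))

section Continuity

variable {X : Type*} [TopologicalSpace X] {k : X → K} {a b c t : X → ℝ}

theorem continuous_frame (hk : Continuous k) (ha : Continuous a) (hb : Continuous b)
    (hc : Continuous c) (ht : Continuous t) :
    Continuous fun x => η.frame (k x) (a x) (b x) (c x) (t x) := by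
  have h0 : Continuous fun x => η.pos (k x) (t x) := η.continuous_pos.comp (hk.prodMk ht)
  have h1 : Continuous fun x => η.vel (k x) (t x) := η.continuous_vel.comp (hk.prodMk ht)
  exact ((ha.smul h0).add (hb.smul h1)).add (hc.smul (h0.cross h1))

theorem continuous_frame₁ (hk : Continuous k) (ha : Continuous a) (hb : Continuous b)
    (hc : Continuous c) (ht : Continuous t) :
    Continuous fun x => η.frame₁ (k x) (a x) (b x) (c x) (t x) := by
  have h0 : Continuous fun x => η.pos (k x) (t x) := η.continuous_pos.comp (hk.prodMk ht)
  have h1 : Continuous fun x => η.vel (k x) (t x) := η.continuous_vel.comp (hk.prodMk ht)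
  have h2 : Continuous fun x => η.acc (k x) (t x) := η.continuous_acc.comp (hk.prodMk ht)
  exact ((ha.smul h1).add (hb.smul h2)).add (hc.smul (h0.cross h2))

theorem continuous_frame₂ (hk : Continuous k) (ha : Continuous a) (hb : Continuous b)
    (hc : Continuous c) (ht : Continuous t) :
    Continuous fun x => η.frame₂ (k x) (a x) (b x) (c x) (t x) := by
  have h0 : Continuous fun x => η.pos (k x) (t x) := η.continuous_pos.comp (hk.prodMk ht)
  have h1 : Continuous fun x => η.vel (k x) (t x) := η.continuous_vel.comp (hk.prodMk ht)
  have h2 : Continuous fun x => η.acc (k x) (t x) := η.continuous_acc.comp (hk.prodMk ht)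
  have h3 : Continuous fun x => η.jerk (k x) (t x) := η.continuous_jerk.comp (hk.prodMk ht)
  exact ((ha.smul h2).add (hb.smul h3)).add (hc.smul ((h1.cross h2).add (h0.cross h3)))

end Continuity

theorem cross_self (x : E3) : cross x x = 0 := by
  apply E3_ext <;> simp only [cross_apply_zero, cross_apply_one, cross_apply_two, PiLp.zero_apply]
    <;> ring

theorem hasDerivAt_frame (k : K) {a b c : ℝ → ℝ} {a' b' c' t : ℝ} (ha : HasDerivAt a a' t)
    (hb : HasDerivAt b b' t) (hc : HasDerivAt c c' t) :
    HasDerivAt (fun t => η.frame k (a t) (b t) (c t) t)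
      (η.frame k a' b' c' t + η.frame₁ k (a t) (b t) (c t) t) t := by
  have h0 := η.hasDerivAt_pos k t
  have h1 := η.hasDerivAt_vel k t
  have h2 := h0.cross h1
  rw [cross_self, zero_add] at h2
  refine (((ha.smul h0).add (hb.smul h1)).add (hc.smul h2)).congr_deriv ?_
  simp only [frame, frame₁]
  abel

theorem hasDerivAt_frame₁ (k : K) {a b c : ℝ → ℝ} {a' b' c' t : ℝ} (ha : HasDerivAt a a' t)
    (hb : HasDerivAt b b' t) (hc : HasDerivAt c c' t) :
    HasDerivAt (fun t => η.frame₁ k (a t) (b t) (c t) t)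
      (η.frame₁ k a' b' c' t + η.frame₂ k (a t) (b t) (c t) t) t := by
  have h0 := η.hasDerivAt_pos k t
  have h1 := η.hasDerivAt_vel k t
  have h2 := η.hasDerivAt_acc k t
  refine (((ha.smul h1).add (hb.smul h2)).add (hc.smul (h0.cross h2))).congr_deriv ?_
  simp only [frame₁, frame₂]
  abel

theorem frame_smul (k : K) (r a b c t : ℝ) :
    η.frame k (r * a) (r * b) (r * c) t = r • η.frame k a b c t := by
  simp only [frame]; module

theorem frame₁_smul (k : K) (r a b c t : ℝ) :
    η.frame₁ k (r * a) (r * b) (r * c) t = r • η.frame₁ k a b c t := by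
  simp only [frame₁]; module

/-- The loop curve, in terms of the cosine `C` and the sine `S` of the fast variable. -/
def loop (s C S : ℝ) (k : K) (t : ℝ) : E3 := η.frame k (loopA s C) (s * loopB C S) (s * loopG s C) t
/-- The derivative of `loop` in the slow variable. -/
def loopT (s C S : ℝ) (k : K) (t : ℝ) : E3 :=
  η.frame₁ k (loopA s C) (s * loopB C S) (s * loopG s C) t
/-- The second derivative of `loop` in the slow variable. -/
def loopTT (s C S : ℝ) (k : K) (t : ℝ) : E3 :=
  η.frame₂ k (loopA s C) (s * loopB C S) (s * loopG s C) t
/-- The derivative of `loop` in the fast variable. -/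
def loopF (s C S : ℝ) (k : K) (t : ℝ) : E3 :=
  η.frame k (loopA₁ s C S) (s * loopB₁ C) (s * loopG₁ s C S) t
/-- The mixed derivative of `loop`. -/
def loopFT (s C S : ℝ) (k : K) (t : ℝ) : E3 :=
  η.frame₁ k (loopA₁ s C S) (s * loopB₁ C) (s * loopG₁ s C S) t
/-- The second derivative of `loop` in the fast variable. -/
def loopFF (s C S : ℝ) (k : K) (t : ℝ) : E3 :=
  η.frame k (loopA₂ s C) (s * loopB₂ C S) (s * loopG₂ s C) t

section Continuity

variable {X : Type*} [TopologicalSpace X] {k : X → K} {s C S t : X → ℝ}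

theorem continuous_loop_all (hs : Continuous s) (hC : Continuous C) (hS : Continuous S)
    (hk : Continuous k) (ht : Continuous t) :
    (Continuous fun x => η.loop (s x) (C x) (S x) (k x) (t x)) ∧
    (Continuous fun x => η.loopT (s x) (C x) (S x) (k x) (t x)) ∧
    (Continuous fun x => η.loopTT (s x) (C x) (S x) (k x) (t x)) ∧
    (Continuous fun x => η.loopF (s x) (C x) (S x) (k x) (t x)) ∧
    (Continuous fun x => η.loopFT (s x) (C x) (S x) (k x) (t x)) ∧
    (Continuous fun x => η.loopFF (s x) (C x) (S x) (k x) (t x)) := by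
  have a0 : Continuous fun x => loopA (s x) (C x) := by unfold loopA loopM; fun_prop
  have a1 : Continuous fun x => loopA₁ (s x) (C x) (S x) := by unfold loopA₁ loopM; fun_prop
  have a2 : Continuous fun x => loopA₂ (s x) (C x) := by unfold loopA₂ loopM; fun_prop
  have b0 : Continuous fun x => s x * loopB (C x) (S x) := by unfold loopB; fun_prop
  have b1 : Continuous fun x => s x * loopB₁ (C x) := by unfold loopB₁; fun_prop
  have b2 : Continuous fun x => s x * loopB₂ (C x) (S x) := by unfold loopB₂; fun_prop
  have c0 : Continuous fun x => s x * loopG (s x) (C x) := by unfold loopG loopM; fun_prop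
  have c1 : Continuous fun x => s x * loopG₁ (s x) (C x) (S x) := by
    unfold loopG₁ loopM; fun_prop
  have c2 : Continuous fun x => s x * loopG₂ (s x) (C x) := by unfold loopG₂ loopM; fun_prop
  exact ⟨η.continuous_frame hk a0 b0 c0 ht, η.continuous_frame₁ hk a0 b0 c0 ht,
    η.continuous_frame₂ hk a0 b0 c0 ht, η.continuous_frame hk a1 b1 c1 ht,
    η.continuous_frame₁ hk a1 b1 c1 ht, η.continuous_frame hk a2 b2 c2 ht⟩

end Continuity

theorem hasDerivAt_loop (M s : ℝ) (k : K) (t : ℝ) :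
    HasDerivAt (fun t => η.loop s (Real.cos (M * t)) (Real.sin (M * t)) k t)
      (η.loopT s (Real.cos (M * t)) (Real.sin (M * t)) k t
        + M • η.loopF s (Real.cos (M * t)) (Real.sin (M * t)) k t) t := by
  have hM : HasDerivAt (fun t : ℝ => M * t) M t := by simpa using (hasDerivAt_id t).const_mul M
  have h := η.hasDerivAt_frame k ((hasDerivAt_loopA s (M * t)).comp t hM)
    (((hasDerivAt_loopB (M * t)).comp t hM).const_mul s)
    (((hasDerivAt_loopG s (M * t)).comp t hM).const_mul s)
  refine h.congr_deriv ?_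
  rw [add_comm, loopT, loopF, ← frame_smul]
  refine congrArg₂ _ rfl ?_
  congr 1 <;> ring

theorem hasDerivAt_loopT (M s : ℝ) (k : K) (t : ℝ) :
    HasDerivAt (fun t => η.loopT s (Real.cos (M * t)) (Real.sin (M * t)) k t)
      (η.loopTT s (Real.cos (M * t)) (Real.sin (M * t)) k t
        + M • η.loopFT s (Real.cos (M * t)) (Real.sin (M * t)) k t) t := by
  have hM : HasDerivAt (fun t : ℝ => M * t) M t := by simpa using (hasDerivAt_id t).const_mul M
  have h := η.hasDerivAt_frame₁ k ((hasDerivAt_loopA s (M * t)).comp t hM)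
    (((hasDerivAt_loopB (M * t)).comp t hM).const_mul s)
    (((hasDerivAt_loopG s (M * t)).comp t hM).const_mul s)
  refine h.congr_deriv ?_
  rw [add_comm, loopTT, loopFT, ← frame₁_smul]
  refine congrArg₂ _ rfl ?_
  congr 1 <;> ring

theorem hasDerivAt_loopF (M s : ℝ) (k : K) (t : ℝ) :
    HasDerivAt (fun t => η.loopF s (Real.cos (M * t)) (Real.sin (M * t)) k t)
      (η.loopFT s (Real.cos (M * t)) (Real.sin (M * t)) k t
        + M • η.loopFF s (Real.cos (M * t)) (Real.sin (M * t)) k t) t := by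
  have hM : HasDerivAt (fun t : ℝ => M * t) M t := by simpa using (hasDerivAt_id t).const_mul M
  have h := η.hasDerivAt_frame k ((hasDerivAt_loopA₁ s (M * t)).comp t hM)
    (((hasDerivAt_loopB₁ (M * t)).comp t hM).const_mul s)
    (((hasDerivAt_loopG₁ s (M * t)).comp t hM).const_mul s)
  refine h.congr_deriv ?_
  rw [add_comm, loopFT, loopFF, ← frame_smul]
  refine congrArg₂ _ rfl ?_
  congr 1 <;> ring

/-- The family of curves that follow `η` along `M / 2π` loops. -/
def loopFamily (M : ℝ) : C2Family (I × K) where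
  pos x t := η.loop x.1 (Real.cos (M * t)) (Real.sin (M * t)) x.2 t
  vel x t := η.loopT x.1 (Real.cos (M * t)) (Real.sin (M * t)) x.2 t
    + M • η.loopF x.1 (Real.cos (M * t)) (Real.sin (M * t)) x.2 t
  acc x t := η.loopTT x.1 (Real.cos (M * t)) (Real.sin (M * t)) x.2 t
    + (2 * M) • η.loopFT x.1 (Real.cos (M * t)) (Real.sin (M * t)) x.2 t
    + M ^ 2 • η.loopFF x.1 (Real.cos (M * t)) (Real.sin (M * t)) x.2 t
  continuous_pos := by
    exact (η.continuous_loop_all (by fun_prop) (by fun_prop) (by fun_prop) (by fun_prop)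
      (by fun_prop)).1
  continuous_vel := by
    obtain ⟨-, h1, -, h2, -, -⟩ := η.continuous_loop_all
      (X := (I × K) × ℝ) (s := fun x => x.1.1) (C := fun x => Real.cos (M * x.2))
      (S := fun x => Real.sin (M * x.2)) (k := fun x => x.1.2) (t := fun x => x.2)
      (by fun_prop) (by fun_prop) (by fun_prop) (by fun_prop) (by fun_prop)
    fun_prop
  continuous_acc := by
    obtain ⟨-, -, h1, -, h2, h3⟩ := η.continuous_loop_all
      (X := (I × K) × ℝ) (s := fun x => x.1.1) (C := fun x => Real.cos (M * x.2))
      (S := fun x => Real.sin (M * x.2)) (k := fun x => x.1.2) (t := fun x => x.2)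
      (by fun_prop) (by fun_prop) (by fun_prop) (by fun_prop) (by fun_prop)
    fun_prop
  hasDerivAt_pos x t := η.hasDerivAt_loop M x.1 x.2 t
  hasDerivAt_vel x t := by
    refine ((η.hasDerivAt_loopT M x.1 x.2 t).add
      ((η.hasDerivAt_loopF M x.1 x.2 t).const_smul M)).congr_deriv ?_
    module

/-- Pairing with `x × y`, `-y` and `x` isolates one coefficient each time, multiplied by `‖x × y‖²`.
-/
theorem coeff_eq_zero_of_cross {x y : E3} (h : cross x y ≠ 0) {p q r : ℝ}
    (h0 : p • cross x y + q • cross x (cross x y) + r • cross y (cross x y) = 0) :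
    p = 0 ∧ q = 0 ∧ r = 0 := by
  have hn : ‖cross x y‖ ^ 2 ≠ 0 := pow_ne_zero 2 (norm_ne_zero_iff.2 h)
  have e := fun z => congrArg (fun v : E3 => inner ℝ v z) h0
  have e1 : p * ‖cross x y‖ ^ 2 = 0 := by
    have := e (cross x y)
    simp only [inner_zero_left] at this
    rw [← this]
    simp only [norm_sq_E3, inner_E3, cross_apply_zero, cross_apply_one, cross_apply_two,
      PiLp.add_apply, PiLp.smul_apply, smul_eq_mul]
    ring
  have e2 : q * ‖cross x y‖ ^ 2 = 0 := by
    have := e (-y)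
    simp only [inner_zero_left] at this
    rw [← this]
    simp only [norm_sq_E3, inner_E3, cross_apply_zero, cross_apply_one, cross_apply_two,
      PiLp.add_apply, PiLp.smul_apply, PiLp.neg_apply, smul_eq_mul]
    ring
  have e3 : r * ‖cross x y‖ ^ 2 = 0 := by
    have := e x
    simp only [inner_zero_left] at this
    rw [← this]
    simp only [norm_sq_E3, inner_E3, cross_apply_zero, cross_apply_one, cross_apply_two,
      PiLp.add_apply, PiLp.smul_apply, smul_eq_mul]
    ring
  exact ⟨(mul_eq_zero.1 e1).resolve_right hn, (mul_eq_zero.1 e2).resolve_right hn,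
    (mul_eq_zero.1 e3).resolve_right hn⟩

/-- The vector `loop × loopF / s`. -/
def loopE (s C S : ℝ) (k : K) (t : ℝ) : E3 :=
  (loopA s C * loopB₁ C - loopA₁ s C S * loopB C S) • cross (η.pos k t) (η.vel k t)
  + (loopA s C * loopG₁ s C S - loopA₁ s C S * loopG s C) •
    cross (η.pos k t) (cross (η.pos k t) (η.vel k t))
  + (s * (loopB C S * loopG₁ s C S - loopB₁ C * loopG s C)) •
    cross (η.vel k t) (cross (η.pos k t) (η.vel k t))

/-- At `s = 0` the fast derivative is radial, so the product is divisible by `s`. The quotient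
`loopE` keeps the direction of the infinitesimal figure eight. -/
theorem cross_loop_loopF (s C S : ℝ) (k : K) (t : ℝ) :
    cross (η.loop s C S k t) (η.loopF s C S k t) = s • η.loopE s C S k t := by
  apply E3_ext <;>
    simp only [loop, loopF, loopE, frame, cross_apply_zero, cross_apply_one, cross_apply_two,
      PiLp.add_apply, PiLp.smul_apply, smul_eq_mul] <;> ring

theorem cross_loop_zero_loopT (C S : ℝ) (k : K) (t : ℝ) :
    cross (η.loop 0 C S k t) (η.loopT 0 C S k t)
      = (loopA 0 C ^ 2) • cross (η.pos k t) (η.vel k t) := by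
  apply E3_ext <;>
    simp only [loop, loopT, frame, frame₁, cross_apply_zero, cross_apply_one, cross_apply_two,
      PiLp.add_apply, PiLp.smul_apply, smul_eq_mul] <;> ring

theorem loop_cross_add_loopE_ne_zero {l s C S : ℝ} {k : K} {t : ℝ}
    (hη : cross (η.pos k t) (η.vel k t) ≠ 0) (h : C ^ 2 + S ^ 2 = 1) (hl : 0 ≤ l) (hl' : l ≤ 1)
    (hs : 0 ≤ s) (hls : l = 0 ∨ s = 0) :
    l • cross (η.loop s C S k t) (η.loopT s C S k t) + (1 - l) • η.loopE s C S k t ≠ 0 := by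
  intro h0
  rcases eq_or_lt_of_le hs with rfl | hs
  · rw [cross_loop_zero_loopT] at h0
    have h1 : (l * loopA 0 C ^ 2 + (1 - l) * (loopA 0 C * loopB₁ C - loopA₁ 0 C S * loopB C S)) •
        cross (η.pos k t) (η.vel k t)
        + ((1 - l) * (loopA 0 C * loopG₁ 0 C S - loopA₁ 0 C S * loopG 0 C)) •
          cross (η.pos k t) (cross (η.pos k t) (η.vel k t))
        + (0 : ℝ) • cross (η.vel k t) (cross (η.pos k t) (η.vel k t)) = 0 := by
      rw [← h0, loopE]
      module
    obtain ⟨e1, e2, -⟩ := coeff_eq_zero_of_cross hη h1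
    exact loop_zero_ne_zero hl hl' h e1 e2
  · have hl0 : l = 0 := hls.resolve_right hs.ne'
    rw [hl0, zero_smul, zero_add, sub_zero, one_smul, loopE] at h0
    obtain ⟨e1, e2, e3⟩ := coeff_eq_zero_of_cross hη h0
    exact loop_minors_ne_zero hs h e1 e2 ((mul_eq_zero.1 e3).resolve_left hs.ne')

theorem Circle_re_sq_add_im_sq (z : Circle) : (z : ℂ).re ^ 2 + (z : ℂ).im ^ 2 = 1 := by
  have := Circle.normSq_coe z
  rw [Complex.normSq_apply] at this
  linarith

theorem eventually_forall_of_continuous {X Y E : Type*} [TopologicalSpace X] [TopologicalSpace Y]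
    [CompactSpace Y] [TopologicalSpace E] {f : X × Y → E} (hf : Continuous f) {U : Set E}
    (hU : IsOpen U) {x₀ : X} (h : ∀ y, f (x₀, y) ∈ U) : ∀ᶠ x in nhds x₀, ∀ y, f (x, y) ∈ U := by
  have := isCompact_univ.eventually_forall_of_forall_eventually (x₀ := x₀)
    (P := fun x (y : Y) => f (x, y) ∈ U) (K := Set.univ)
    fun y _ => hf.continuousAt.eventually_mem (hU.mem_nhds (h y))
  simpa using this

theorem det_frame (k : K) (t a b c a' b' c' a'' b'' c'' : ℝ) :
    (cols (η.frame k a b c t) (η.frame k a' b' c' t) (η.frame k a'' b'' c'' t)).det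
      = (a * (b' * c'' - c' * b'') - b * (a' * c'' - c' * a'') + c * (a' * b'' - b' * a''))
        * ‖cross (η.pos k t) (η.vel k t)‖ ^ 2 := by
  simp only [det_cols, norm_sq_E3, frame, cross_apply_zero, cross_apply_one, cross_apply_two,
    PiLp.add_apply, PiLp.smul_apply, smul_eq_mul]
  ring

theorem det_cols_smul (x y z : E3) (r : ℝ) :
    (cols x (r • y) (r ^ 2 • z)).det = r ^ 3 * (cols x y z).det := by
  simp only [det_cols, PiLp.smul_apply, smul_eq_mul]; ring

variable [CompactSpace K]

/-- Along many loops, the curves of the family are immersed. -/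
theorem eventually_cross_loopFamily_ne_zero
    (hη : ∀ k (t : I), cross (η.pos k t) (η.vel k t) ≠ 0) :
    ∀ᶠ M in Filter.atTop, ∀ (x : I × K) (t : I),
      cross ((η.loopFamily M).pos x t) ((η.loopFamily M).vel x t) ≠ 0 := by
  -- Position × velocity is `(1 + M s) • W` at `l = 1 / (1 + M s)`. A free point of the circle
  -- replaces the phase `M t`, so that `W` does not depend on `M` and its last variables range over
  -- a compact space.
  let W : ℝ × ℝ × K × I × Circle → E3 := fun x =>
    x.1 • cross (η.loop x.2.1 (x.2.2.2.2 : ℂ).re (x.2.2.2.2 : ℂ).im x.2.2.1 x.2.2.2.1)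
      (η.loopT x.2.1 (x.2.2.2.2 : ℂ).re (x.2.2.2.2 : ℂ).im x.2.2.1 x.2.2.2.1)
    + (1 - x.1) • η.loopE x.2.1 (x.2.2.2.2 : ℂ).re (x.2.2.2.2 : ℂ).im x.2.2.1 x.2.2.2.1
  have hre : Continuous fun x : ℝ × ℝ × K × I × Circle => (x.2.2.2.2 : ℂ).re :=
    Complex.continuous_re.comp (by fun_prop)
  have him : Continuous fun x : ℝ × ℝ × K × I × Circle => (x.2.2.2.2 : ℂ).im :=
    Complex.continuous_im.comp (by fun_prop)
  have hW : Continuous W := by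
    obtain ⟨h1, h2, -, -, -, -⟩ := η.continuous_loop_all
      (s := fun x : ℝ × ℝ × K × I × Circle => x.2.1) (k := fun x => x.2.2.1)
      (t := fun x => x.2.2.2.1) (by fun_prop) hre him (by fun_prop) (by fun_prop)
    have hp : Continuous fun x : ℝ × ℝ × K × I × Circle => η.pos x.2.2.1 x.2.2.2.1 :=
      η.continuous_pos.comp
        (by fun_prop : Continuous fun x : ℝ × ℝ × K × I × Circle => (x.2.2.1, (x.2.2.2.1 : ℝ)))
    have hv : Continuous fun x : ℝ × ℝ × K × I × Circle => η.vel x.2.2.1 x.2.2.2.1 :=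
      η.continuous_vel.comp
        (by fun_prop : Continuous fun x : ℝ × ℝ × K × I × Circle => (x.2.2.1, (x.2.2.2.1 : ℝ)))
    have hE : Continuous fun x : ℝ × ℝ × K × I × Circle =>
        η.loopE x.2.1 (x.2.2.2.2 : ℂ).re (x.2.2.2.2 : ℂ).im x.2.2.1 x.2.2.2.1 := by
      have c1 := hp.cross hv
      have c2 := hp.cross c1
      have c3 := hv.cross c1
      unfold loopE loopA loopA₁ loopB loopB₁ loopG loopG₁ loopM
      fun_prop
    have := h1.cross h2
    fun_prop
  have key : ∀ (l s : I) (y : K × I × Circle), (l = 0 ∨ s = 0) → W (l, s, y) ≠ 0 := by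
    rintro l s ⟨k, t, z⟩ hls
    refine η.loop_cross_add_loopE_ne_zero (hη k t) (Circle_re_sq_add_im_sq z) l.2.1 l.2.2 s.2.1 ?_
    rcases hls with rfl | rfl
    · exact Or.inl rfl
    · exact Or.inr rfl
  have h1 : ∀ᶠ l : ℝ in nhds 0, ∀ y : I × K × I × Circle, W (l, (y.1 : ℝ), y.2) ∈ ({0}ᶜ : Set E3) :=
    eventually_forall_of_continuous (f := fun x : ℝ × I × K × I × Circle =>
      W (x.1, (x.2.1 : ℝ), x.2.2)) (hW.comp (by fun_prop)) isOpen_compl_singleton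
      fun y => key 0 y.1 y.2 (Or.inl rfl)
  have h2 : ∀ᶠ s : ℝ in nhds 0, ∀ y : I × K × I × Circle, W ((y.1 : ℝ), s, y.2) ∈ ({0}ᶜ : Set E3) :=
    eventually_forall_of_continuous (f := fun x : ℝ × I × K × I × Circle =>
      W ((x.2.1 : ℝ), x.1, x.2.2)) (hW.comp (by fun_prop)) isOpen_compl_singleton
      fun y => key y.1 0 y.2 (Or.inr rfl)
  obtain ⟨d, hd, hball⟩ := Metric.eventually_nhds_iff.1 (h1.and h2)
  -- If `s ≥ d`, then `M s d ≥ M d ^ 2 > 1`, hence `l < d`. So one of the two neighbourhoods always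
  -- applies.
  filter_upwards [Filter.eventually_gt_atTop (1 / d ^ 2), Filter.eventually_gt_atTop 0]
    with M hM hM0 x t h0
  have hs := x.1.2.1
  set z : Circle := Circle.exp (M * t) with hz
  have hzre : (z : ℂ).re = Real.cos (M * t) := by
    rw [hz, Circle.coe_exp, Complex.exp_ofReal_mul_I_re]
  have hzim : (z : ℂ).im = Real.sin (M * t) := by
    rw [hz, Circle.coe_exp, Complex.exp_ofReal_mul_I_im]
  have hpos : 0 < 1 + M * x.1 := by positivity
  set l : ℝ := 1 / (1 + M * x.1) with hl
  have hl0 : 0 ≤ l := by positivity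
  have hl1 : l ≤ 1 := by
    rw [hl, div_le_one hpos]
    linarith [mul_nonneg hM0.le hs]
  have hW0 : W (l, (x.1 : ℝ), x.2, t, z) = 0 := by
    have e1 : (1 + M * (x.1 : ℝ)) • W (l, (x.1 : ℝ), x.2, t, z)
        = cross ((η.loopFamily M).pos x t) ((η.loopFamily M).vel x t) := by
      have e2 : cross ((η.loopFamily M).pos x t) ((η.loopFamily M).vel x t)
          = cross (η.loop x.1 (Real.cos (M * t)) (Real.sin (M * t)) x.2 t)
            (η.loopT x.1 (Real.cos (M * t)) (Real.sin (M * t)) x.2 t)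
            + M • cross (η.loop x.1 (Real.cos (M * t)) (Real.sin (M * t)) x.2 t)
              (η.loopF x.1 (Real.cos (M * t)) (Real.sin (M * t)) x.2 t) := by
        rw [← crossL_apply, ← crossL_apply, ← crossL_apply, ← map_smul, ← map_add]
        rfl
      rw [e2, cross_loop_loopF, ← hzre, ← hzim]
      simp only [W]
      rw [smul_add, smul_smul, smul_smul, smul_smul]
      have a1 : (1 + M * (x.1 : ℝ)) * l = 1 := by rw [hl]; field_simp
      have a2 : (1 + M * (x.1 : ℝ)) * (1 - l) = M * x.1 := by rw [mul_sub, a1]; ring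
      rw [a1, a2, one_smul]
    rw [h0] at e1
    exact (smul_eq_zero.1 e1).resolve_left hpos.ne'
  by_cases hsd : (x.1 : ℝ) < d
  · have := (hball (y := (x.1 : ℝ)) (by rwa [Real.dist_eq, sub_zero, abs_of_nonneg hs])).2
      (⟨l, hl0, hl1⟩, x.2, t, z)
    exact this hW0
  · have hld : l < d := by
      rw [hl, div_lt_iff₀ hpos]
      rw [div_lt_iff₀ (by positivity)] at hM
      have : M * d ≤ M * x.1 := mul_le_mul_of_nonneg_left (not_lt.1 hsd) hM0.le
      nlinarith
    have := (hball (y := l) (by rwa [Real.dist_eq, sub_zero, abs_of_nonneg hl0])).1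
      (x.1, x.2, t, z)
    exact this hW0

/-- Along many loops, the curves of the family with `s = 1` are locally convex. -/
theorem eventually_det_loopFamily_pos
    (hη : ∀ k (t : I), cross (η.pos k t) (η.vel k t) ≠ 0) :
    ∀ᶠ M in Filter.atTop, ∀ (k : K) (t : I), 0 < (cols ((η.loopFamily M).pos (1, k) t)
      ((η.loopFamily M).vel (1, k) t) ((η.loopFamily M).acc (1, k) t)).det := by
  -- The determinant divided by `M ^ 3`, with `x.1` in the role of `1 / M`. At `x.1 = 0` only the
  -- fast derivatives remain, and the value is that of `loop_det_pos` times `‖η × η'‖²`.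
  let G : ℝ × K × I × Circle → ℝ := fun x =>
    (cols (η.loop 1 (x.2.2.2 : ℂ).re (x.2.2.2 : ℂ).im x.2.1 x.2.2.1)
      (x.1 • η.loopT 1 (x.2.2.2 : ℂ).re (x.2.2.2 : ℂ).im x.2.1 x.2.2.1
        + η.loopF 1 (x.2.2.2 : ℂ).re (x.2.2.2 : ℂ).im x.2.1 x.2.2.1)
      (x.1 ^ 2 • η.loopTT 1 (x.2.2.2 : ℂ).re (x.2.2.2 : ℂ).im x.2.1 x.2.2.1
        + (2 * x.1) • η.loopFT 1 (x.2.2.2 : ℂ).re (x.2.2.2 : ℂ).im x.2.1 x.2.2.1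
        + η.loopFF 1 (x.2.2.2 : ℂ).re (x.2.2.2 : ℂ).im x.2.1 x.2.2.1)).det
  have hG : Continuous G := by
    have hre : Continuous fun x : ℝ × K × I × Circle => (x.2.2.2 : ℂ).re :=
      Complex.continuous_re.comp (by fun_prop)
    have him : Continuous fun x : ℝ × K × I × Circle => (x.2.2.2 : ℂ).im :=
      Complex.continuous_im.comp (by fun_prop)
    obtain ⟨h1, h2, h3, h4, h5, h6⟩ := η.continuous_loop_all
      (s := fun _ : ℝ × K × I × Circle => 1) (k := fun x => x.2.1)
      (t := fun x => x.2.2.1) (by fun_prop) hre him (by fun_prop) (by fun_prop)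
    simp only [G, det_cols]
    fun_prop
  have h0 : ∀ y, G (0, y) ∈ Set.Ioi (0 : ℝ) := by
    rintro ⟨k, t, z⟩
    have hc := loop_det_pos (Circle_re_sq_add_im_sq z)
    simp only [G, zero_smul, zero_add, mul_zero, ne_eq, OfNat.ofNat_ne_zero, not_false_eq_true,
      zero_pow, Set.mem_Ioi]
    rw [loop, loopF, loopFF, det_frame]
    simp only [one_mul]
    have := norm_pos_iff.2 (hη k t)
    positivity
  have h1 := eventually_forall_of_continuous hG isOpen_Ioi h0
  filter_upwards [tendsto_inv_atTop_zero.eventually h1, Filter.eventually_gt_atTop 0]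
    with M hM hM0 k t
  set z : Circle := Circle.exp (M * t) with hz
  have hzre : (z : ℂ).re = Real.cos (M * t) := by
    rw [hz, Circle.coe_exp, Complex.exp_ofReal_mul_I_re]
  have hzim : (z : ℂ).im = Real.sin (M * t) := by
    rw [hz, Circle.coe_exp, Complex.exp_ofReal_mul_I_im]
  have h2 : 0 < G (M⁻¹, k, t, z) := hM (k, t, z)
  have h3 : (cols ((η.loopFamily M).pos (1, k) t) ((η.loopFamily M).vel (1, k) t)
      ((η.loopFamily M).acc (1, k) t)).det = M ^ 3 * G (M⁻¹, k, t, z) := by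
    simp only [G]
    rw [← det_cols_smul, hzre, hzim, smul_add, smul_add, smul_add, smul_smul, smul_smul, smul_smul,
      mul_inv_cancel₀ hM0.ne', one_smul]
    have a1 : M ^ 2 * M⁻¹ ^ 2 = 1 := by rw [← mul_pow, mul_inv_cancel₀ hM0.ne', one_pow]
    have a2 : M ^ 2 * (2 * M⁻¹) = 2 * M := by field_simp
    rw [a1, a2, one_smul]
    rfl
  rw [h3]
  positivity

end C3Family

/-! ### Change of time and the deformation to locally convex curves. -/

/-- The diffeomorphism of the unit interval with derivative `d` at both ends. -/
def timeChange (d u : ℝ) : ℝ := d * u + (1 - d) * (3 * u ^ 2 - 2 * u ^ 3)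
def timeChange₁ (d u : ℝ) : ℝ := d + (1 - d) * (6 * u * (1 - u))
def timeChange₂ (d u : ℝ) : ℝ := (1 - d) * (6 - 12 * u)

theorem hasDerivAt_timeChange (d u : ℝ) :
    HasDerivAt (timeChange d) (timeChange₁ d u) u := by
  refine (((hasDerivAt_id u).const_mul d).add ((((hasDerivAt_pow 2 u).const_mul 3).sub
    ((hasDerivAt_pow 3 u).const_mul 2)).const_mul (1 - d))).congr_deriv ?_
  simp only [timeChange₁]
  push_cast
  ring

theorem hasDerivAt_timeChange₁ (d u : ℝ) :
    HasDerivAt (timeChange₁ d) (timeChange₂ d u) u := by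
  refine (((((hasDerivAt_id u).const_mul 6).mul ((hasDerivAt_id u).const_sub 1)).const_mul
    (1 - d)).const_add d).congr_deriv ?_
  simp only [timeChange₂, id]
  ring

theorem timeChange₁_pos {d u : ℝ} (hd : 0 < d) (hd' : d ≤ 1) (hu : u ∈ I) :
    0 < timeChange₁ d u := by
  have : 0 ≤ (1 - d) * (6 * u * (1 - u)) := mul_nonneg (by linarith)
    (mul_nonneg (by linarith [hu.1]) (by linarith [hu.2]))
  unfold timeChange₁
  linarith

theorem timeChange_mem {d u : ℝ} (hd : 0 < d) (hd' : d ≤ 1) (hu : u ∈ I) :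
    timeChange d u ∈ I := by
  obtain ⟨h0, h1⟩ := hu
  have e0 : 0 ≤ 3 * u ^ 2 - 2 * u ^ 3 := by
    have : 0 ≤ u ^ 2 * (3 - 2 * u) := mul_nonneg (sq_nonneg u) (by linarith)
    linarith
  have e1 : 3 * u ^ 2 - 2 * u ^ 3 ≤ 1 := by
    have : 0 ≤ (1 - u) ^ 2 * (1 + 2 * u) := mul_nonneg (sq_nonneg _) (by linarith)
    linarith
  have e2 : 0 ≤ 1 - d := by linarith
  unfold timeChange
  constructor
  · positivity
  · nlinarith

/-- The change of time of a family of curves. -/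
def C2Family.reparam {X : Type*} [TopologicalSpace X] (F : C2Family X) (d : C(X, ℝ)) :
    C2Family X where
  pos x u := F.pos x (timeChange (d x) u)
  vel x u := timeChange₁ (d x) u • F.vel x (timeChange (d x) u)
  acc x u := timeChange₂ (d x) u • F.vel x (timeChange (d x) u)
    + timeChange₁ (d x) u ^ 2 • F.acc x (timeChange (d x) u)
  continuous_pos := F.continuous_pos.comp
    (by unfold timeChange; fun_prop : Continuous fun x : X × ℝ => (x.1, timeChange (d x.1) x.2))
  continuous_vel := by
    have := F.continuous_vel.comp
      (by unfold timeChange; fun_prop : Continuous fun x : X × ℝ => (x.1, timeChange (d x.1) x.2))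
    simp only [Function.comp_def] at this
    unfold timeChange₁
    fun_prop
  continuous_acc := by
    have h := (by unfold timeChange; fun_prop :
      Continuous fun x : X × ℝ => (x.1, timeChange (d x.1) x.2))
    have h1 := F.continuous_vel.comp h
    have h2 := F.continuous_acc.comp h
    simp only [Function.comp_def] at h1 h2
    unfold timeChange₁ timeChange₂
    fun_prop
  hasDerivAt_pos x u := (F.hasDerivAt_pos x _).scomp u (hasDerivAt_timeChange (d x) u)
  hasDerivAt_vel x u := by
    refine ((hasDerivAt_timeChange₁ (d x) u).smul
      ((F.hasDerivAt_vel x _).scomp u (hasDerivAt_timeChange (d x) u))).congr_deriv ?_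
    simp only [Function.comp_apply]
    module

section Loops

variable {K : Type*} [TopologicalSpace K]

/-- The derivative at the ends of the change of time that restores the initial velocity. -/
def endSpeed {M : ℝ} (hM : 0 ≤ M) : C(I × K, ℝ) where
  toFun x := (1 + M * (x.1 / 8))⁻¹
  continuous_toFun := by
    refine Continuous.inv₀ (by fun_prop) fun x => ?_
    have := x.1.2.1
    positivity

theorem endSpeed_pos {M : ℝ} (hM : 0 ≤ M) (x : I × K) : 0 < endSpeed hM x := by
  have := x.1.2.1
  show 0 < (1 + M * ((x.1 : ℝ) / 8))⁻¹
  positivity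

theorem endSpeed_le_one {M : ℝ} (hM : 0 ≤ M) (x : I × K) : endSpeed hM x ≤ 1 := by
  have := x.1.2.1
  refine inv_le_one_of_one_le₀ ?_
  have : 0 ≤ M * ((x.1 : ℝ) / 8) := by positivity
  linarith

theorem loop_one_zero (η : C3Family K) (s : ℝ) (k : K) (t : ℝ) :
    η.loop s 1 0 k t = η.pos k t := by
  have h1 : loopA s 1 = 1 := by unfold loopA; ring
  have h2 : loopB 1 0 = 0 := by unfold loopB; ring
  have h3 : loopG s 1 = 0 := by unfold loopG; ring
  simp [C3Family.loop, C3Family.frame, h1, h2, h3]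

theorem loopT_one_zero (η : C3Family K) (s : ℝ) (k : K) (t : ℝ) :
    η.loopT s 1 0 k t = η.vel k t := by
  have h1 : loopA s 1 = 1 := by unfold loopA; ring
  have h2 : loopB 1 0 = 0 := by unfold loopB; ring
  have h3 : loopG s 1 = 0 := by unfold loopG; ring
  simp [C3Family.loopT, C3Family.frame₁, h1, h2, h3]

/-- At its base point the looped curve therefore has velocity `(1 + M s / 8) η'`; `endSpeed` is the
inverse of this factor. -/
theorem loopF_one_zero (η : C3Family K) (s : ℝ) (k : K) (t : ℝ) :
    η.loopF s 1 0 k t = (s / 8) • η.vel k t := by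
  have h1 : loopA₁ s 1 0 = 0 := by unfold loopA₁; ring
  have h2 : loopB₁ 1 = 1 / 8 := by unfold loopB₁; ring
  have h3 : loopG₁ s 1 0 = 0 := by unfold loopG₁; ring
  simp [C3Family.loopF, C3Family.frame, h1, h2, h3, div_eq_mul_inv]

theorem loop_zero (η : C3Family K) (C S : ℝ) (k : K) (t : ℝ) :
    η.loop 0 C S k t = (2 - C ^ 2) • η.pos k t := by
  have h1 : loopA 0 C = 2 - C ^ 2 := by simp only [loopA, loopM]; ring
  simp [C3Family.loop, C3Family.frame, h1]

variable [CompactSpace K]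

/-- A family of smooth curves can be deformed to locally convex curves. -/
theorem exists_deformation_locallyConvex {η : C3Family K} (hη : ∀ k, (η.curve k).Regular) :
    ∃ F : C2Family (I × K), (∀ x, (F.curve x).Regular) ∧
      (∀ k (t : I), ∃ r : ℝ, 0 < r ∧ F.pos (0, k) t = r • η.pos k t) ∧
      ∀ k (t : I), 0 < (cols (F.pos (1, k) t) (F.vel (1, k) t) (F.acc (1, k) t)).det := by
  have hcross : ∀ k (t : I), cross (η.pos k t) (η.vel k t) ≠ 0 := fun k t =>
    (hη k).cross_ne_zero t
  -- Whole numbers of loops, so that the curve is at the base point of the loop also at time `1`.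
  have htend : Filter.Tendsto (fun n : ℕ => (n : ℝ) * (2 * Real.pi)) Filter.atTop Filter.atTop :=
    tendsto_natCast_atTop_atTop.atTop_mul_const Real.two_pi_pos
  obtain ⟨n, hn1, hn2⟩ := (htend.eventually ((η.eventually_cross_loopFamily_ne_zero hcross).and
    (η.eventually_det_loopFamily_pos hcross))).exists
  set M : ℝ := (n : ℝ) * (2 * Real.pi) with hMdef
  have hM : 0 ≤ M := by have := Real.two_pi_pos; positivity
  have hcos : Real.cos M = 1 := Real.cos_nat_mul_two_pi n
  have hsin : Real.sin M = 0 := by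
    have := Real.sin_add_nat_mul_two_pi 0 n
    rwa [zero_add, Real.sin_zero] at this
  let φ : I × K → I → I := fun x t =>
    ⟨timeChange (endSpeed hM x) t, timeChange_mem (endSpeed_pos hM x) (endSpeed_le_one hM x) t.2⟩
  have hspeed : ∀ x : I × K, endSpeed hM x * (1 + M * (x.1 / 8)) = 1 := fun x =>
    inv_mul_cancel₀ (by have := x.1.2.1; positivity)
  have hvel : ∀ (x : I × K) (t : ℝ), endSpeed hM x • (η.vel x.2 t
      + M • ((x.1 : ℝ) / 8) • η.vel x.2 t) = η.vel x.2 t := by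
    intro x t
    have h : endSpeed hM x • (η.vel x.2 t + M • ((x.1 : ℝ) / 8) • η.vel x.2 t)
        = (endSpeed hM x * (1 + M * (x.1 / 8))) • η.vel x.2 t := by module
    rw [h, hspeed, one_smul]
  have t0 : ∀ d, timeChange d 0 = 0 := fun d => by unfold timeChange; ring
  have t1 : ∀ d, timeChange d 1 = 1 := fun d => by unfold timeChange; ring
  have t0' : ∀ d, timeChange₁ d 0 = d := fun d => by unfold timeChange₁; ring
  have t1' : ∀ d, timeChange₁ d 1 = d := fun d => by unfold timeChange₁; ring
  refine ⟨(η.loopFamily M).reparam (endSpeed hM), fun x => ⟨fun t => ?_, ?_, ?_, ?_, ?_⟩,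
    fun k t => ?_, fun k t => ?_⟩
  · have h1 := hn1 x (φ x t)
    have h2 := timeChange₁_pos (endSpeed_pos hM x) (endSpeed_le_one hM x) t.2
    show cross ((η.loopFamily M).pos x (φ x t))
      (timeChange₁ (endSpeed hM x) t • (η.loopFamily M).vel x (φ x t)) ≠ 0
    rw [← crossL_apply, map_smul]
    exact smul_ne_zero h2.ne' h1
  · show η.loop x.1 (Real.cos (M * timeChange (endSpeed hM x) 0))
      (Real.sin (M * timeChange (endSpeed hM x) 0)) x.2 (timeChange (endSpeed hM x) 0) = e 0
    rw [t0, mul_zero, Real.cos_zero, Real.sin_zero, loop_one_zero]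
    exact (hη x.2).pos_zero
  · show η.loop x.1 (Real.cos (M * timeChange (endSpeed hM x) 1))
      (Real.sin (M * timeChange (endSpeed hM x) 1)) x.2 (timeChange (endSpeed hM x) 1) = e 0
    rw [t1, mul_one, hcos, hsin, loop_one_zero]
    exact (hη x.2).pos_one
  · show timeChange₁ (endSpeed hM x) 0 • (η.loopT x.1
      (Real.cos (M * timeChange (endSpeed hM x) 0)) (Real.sin (M * timeChange (endSpeed hM x) 0))
      x.2 (timeChange (endSpeed hM x) 0) + M • η.loopF x.1
      (Real.cos (M * timeChange (endSpeed hM x) 0)) (Real.sin (M * timeChange (endSpeed hM x) 0))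
      x.2 (timeChange (endSpeed hM x) 0)) = e 1
    rw [t0, t0', mul_zero, Real.cos_zero, Real.sin_zero, loopT_one_zero, loopF_one_zero, hvel]
    exact (hη x.2).vel_zero
  · show timeChange₁ (endSpeed hM x) 1 • (η.loopT x.1
      (Real.cos (M * timeChange (endSpeed hM x) 1)) (Real.sin (M * timeChange (endSpeed hM x) 1))
      x.2 (timeChange (endSpeed hM x) 1) + M • η.loopF x.1
      (Real.cos (M * timeChange (endSpeed hM x) 1)) (Real.sin (M * timeChange (endSpeed hM x) 1))
      x.2 (timeChange (endSpeed hM x) 1)) = e 1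
    rw [t1, t1', mul_one, hcos, hsin, loopT_one_zero, loopF_one_zero, hvel]
    exact (hη x.2).vel_one
  · have h1 : timeChange (endSpeed hM ((0 : I), k)) t = t := by
      have : endSpeed hM ((0 : I), k) = 1 := by simp [endSpeed]
      rw [this]
      unfold timeChange
      ring
    refine ⟨2 - Real.cos (M * t) ^ 2, by linarith [Real.cos_sq_le_one (M * t)], ?_⟩
    show η.loop (0 : I) (Real.cos (M * timeChange (endSpeed hM ((0 : I), k)) t))
      (Real.sin (M * timeChange (endSpeed hM ((0 : I), k)) t)) k
      (timeChange (endSpeed hM ((0 : I), k)) t) = _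
    rw [h1, Set.Icc.coe_zero, loop_zero]
  · have h1 := hn2 k (φ (1, k) t)
    have h2 := timeChange₁_pos (endSpeed_pos hM ((1 : I), k)) (endSpeed_le_one hM ((1 : I), k)) t.2
    set d₁ := timeChange₁ (endSpeed hM ((1 : I), k)) t
    have h3 : (cols ((η.loopFamily M).pos (1, k) (φ (1, k) t))
        (d₁ • (η.loopFamily M).vel (1, k) (φ (1, k) t))
        (timeChange₂ (endSpeed hM ((1 : I), k)) t • (η.loopFamily M).vel (1, k) (φ (1, k) t)
          + d₁ ^ 2 • (η.loopFamily M).acc (1, k) (φ (1, k) t))).det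
        = d₁ ^ 3 * (cols ((η.loopFamily M).pos (1, k) (φ (1, k) t))
        ((η.loopFamily M).vel (1, k) (φ (1, k) t))
        ((η.loopFamily M).acc (1, k) (φ (1, k) t))).det := by
      simp only [det_cols, PiLp.add_apply, PiLp.smul_apply, smul_eq_mul]; ring
    refine lt_of_lt_of_eq ?_ h3.symm
    positivity

end Loops

/-! ### The homotopy. -/

theorem radial_smul {r : ℝ} (hr : 0 < r) (x : E3) : radial (r • x) = radial x := by
  rw [radial, radial, norm_smul, Real.norm_of_nonneg hr.le, smul_smul]
  congr 1
  field_simp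

theorem homotopic_of_mem_immersionsSign {ε : ℤˣ} {K : Type*} [TopologicalSpace K]
    (f g : C(K, ImmersionsSign ε)) {H : I × K → H2Curve} (hH : Continuous H)
    (hmem : ∀ x, H x ∈ ImmersionsSign ε) (h0 : ∀ k, H (0, k) = f k) (h1 : ∀ k, H (1, k) = g k) :
    f.Homotopic g :=
  ⟨{ toFun := fun x => ⟨H x, hmem x⟩
     continuous_toFun := hH.subtype_mk _
     map_zero_left := fun k => Subtype.ext (h0 k)
     map_one_left := fun k => Subtype.ext (h1 k) }⟩

theorem weaklyHomotopicallySurjective_inclusion (ε : ℤˣ) :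
    WeaklyHomotopicallySurjective.{u} (inclusion ε) := by
  intro K _ _ f
  have hf : Continuous fun k => (f k).1 := continuous_subtype_val.comp f.continuous
  obtain ⟨η, hη⟩ := exists_C3Family_regular hf fun k => (f k).2.1
  have hηr : ∀ k, (η.curve k).Regular := fun k => by
    have := hη 1 k
    rwa [Set.Icc.coe_one, H2Curve.lerp_one] at this
  obtain ⟨F, hF, hF0, hF1⟩ := exists_deformation_locallyConvex hηr
  let H₁ : I × K → H2Curve := fun x => (H2Curve.lerp x.1 (f x.2).1 (η.curve x.2)).normalize
    (hη x.1 x.2).pos_ne_zero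
  have hH₁ : Continuous H₁ := H2Curve.continuous_normalize
    (H2Curve.continuous_lerp (by fun_prop) (hf.comp continuous_snd)
      (η.continuous_curve.comp continuous_snd)) _
  have hm₁ : ∀ x, H₁ x ∈ Immersions := fun x => (hη x.1 x.2).normalize_mem
  have h₁0 : ∀ k, H₁ (0, k) = f k := fun k => by
    refine H2Curve.eq_of_pos_eq (ContinuousMap.ext fun t => ?_)
    show radial ((H2Curve.lerp (0 : I) (f k).1 (η.curve k)).pos t) = (f k).1.pos t
    rw [Set.Icc.coe_zero, H2Curve.lerp_zero, H2Curve.radial_eq_self ((f k).2.1.1 t)]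
  let H₂ : I × K → H2Curve := fun x => (F.curve x).normalize (hF x).pos_ne_zero
  have hH₂ : Continuous H₂ := H2Curve.continuous_normalize F.continuous_curve _
  have hm₂ : ∀ x, H₂ x ∈ Immersions := fun x => (hF x).normalize_mem
  -- At the junction both curves are the radial projection of `η`, since `F` starts at a positive
  -- multiple of `η`.
  have h₁₂ : ∀ k, H₁ (1, k) = H₂ (0, k) := fun k => by
    refine H2Curve.eq_of_pos_eq (ContinuousMap.ext fun t => ?_)
    show radial ((H2Curve.lerp (1 : I) (f k).1 (η.curve k)).pos t) = radial (F.pos (0, k) t)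
    obtain ⟨r, hr, hr'⟩ := hF0 k t
    rw [Set.Icc.coe_one, H2Curve.lerp_one, hr', radial_smul hr]
    rfl
  -- The sign is carried from `f` along the first homotopy, then from its end along the second.
  have hs₁ : ∀ x, H₁ x ∈ ImmersionsSign ε := fun x =>
    H2Curve.mem_immersionsSign_of_path (f := fun s => H₁ (s, x.2)) (hH₁.comp (by fun_prop))
      (fun s => hm₁ _) (by rw [h₁0]; exact (f x.2).2) x.1
  have hs₂ : ∀ x, H₂ x ∈ ImmersionsSign ε := fun x =>
    H2Curve.mem_immersionsSign_of_path (f := fun s => H₂ (s, x.2)) (hH₂.comp (by fun_prop))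
      (fun s => hm₂ _) (by rw [← h₁₂]; exact hs₁ _) x.1
  have hconv : ∀ k, H₂ (1, k) ∈ LocallyConvex := fun k => by
    refine (hF (1, k)).normalize_mem_locallyConvex ?_
    filter_upwards [F.curve_acc (1, k)] with t ht
    rw [ht]
    exact hF1 k t
  let m : C(K, ImmersionsSign ε) :=
    ⟨fun k => ⟨H₁ (1, k), hs₁ _⟩, (hH₁.comp (by fun_prop)).subtype_mk _⟩
  let g : C(K, LocallyConvexSign ε) :=
    ⟨fun k => ⟨H₂ (1, k), hs₂ _, hconv k⟩, (hH₂.comp (by fun_prop)).subtype_mk _⟩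
  exact ⟨g, (homotopic_of_mem_immersionsSign f m hH₁ hs₁ h₁0 fun _ => rfl).trans
    (homotopic_of_mem_immersionsSign m ((inclusion ε).comp g) hH₂ hs₂ (fun k => (h₁₂ k).symm)
      fun _ => rfl)⟩

end LittleSpaces

end

theorem theorem1 (ε : ℤˣ) :
    LittleSpaces.WeaklyHomotopicallySurjective.{u} (LittleSpaces.inclusion ε) :=
  LittleSpaces.weaklyHomotopicallySurjective_inclusion ε
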